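/- **Setting.** Let $\mathcal A$ be a finite alphabet and $D\ge 1$; for $r\ge 0$ let $\mathbb B(r)=\{-r,\dots,r\}^D$. For $\mathfrak A\subseteq\mathcal A^{\mathbb Z^D}$ let $\mathfrak A_{(r)}=\{\mathbf c|_{\mathbb B(r)}:\mathbf c\in\mathfrak A\}$. Let $\mathfrak A$ be a subshift of finite type of radius $R$, i.e. $\mathfrak A=\{\mathbf a:\mathbf a_{\mathsf z+\mathbb B(R)}\in\mathfrak A_{(R)}\ \forall \mathsf z\in\mathbb Z^D\}$. *Unflawed regions.* For $\mathbf a\in\mathcal A^{\mathbb Z^D}$ let $\mathbb G_r(\mathbf a)=\{\mathsf z:\mathbf a_{\mathsf z+\mathbb B(r)}\in\mathfrak A_{(r)}\}$, and let $\mathbf G_r(\mathbf a)\subseteq\mathbb R^D$ be the union of all unit cubes $\mathsf z+[0,1]^D$ ($\mathsf z\in\mathbb Z^D$) all of whose corners lie in $\mathbb G_r(\mathbf a)$. Then $\mathbf G_{r+1}(\mathbf a)\subseteq \mathbf G_r(\mathbf a)$. *Tile complexes.* Let $\mathbf X_r$ be the quotient of the disjoint union of cubes $(\mathsf z,w)$,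 $\mathsf z\in\mathbb Z^D$, $w\in\mathfrak A_{(r)}$ (a copy of $\mathsf z+[0,1]^D$), obtained by gluing, for each direction $d$, the upper $d$-face of $(\mathsf z,w)$ to the lower $d$-face of $(\mathsf z+\mathsf e_d,w')$ whenever $w_{\mathsf u}=w'_{\mathsf u-\mathsf e_d}$ for all $\mathsf u$ with $\mathsf u,\mathsf u-\mathsf e_d\in\mathbb B(r)$. Let $\Pi_r:\mathbf X_r\to\mathbb R^D$ be the projection, $\zeta:\mathbf X_s\to\mathbf X_r$ ($r\le s$) the map restricting labels, and, for $\mathbf c\in\mathfrak A$, $x_r(\mathbf c)$ the corner over $0$ of the cube $(0,\mathbf c|_{\mathbb B(r)})$. Every $\mathbf a$ defines a continuous section $\varsigma^r_{\mathbf a}:\mathbf G_r(\mathbf a)\to\mathbf X_r$ of $\Pi_r$, sending the cube at $\mathsf z$ to the cube $(\mathsf z,\mathbf a_{\mathsf z+\mathbb B(r)})$. *Limit groups* (all limits over $r\ge R$). For an abelian group $G$ let $\mathcal H_k[\mathbb G_\infty(\mathbf a),G]=\varprojlim H_k(\mathbf G_r(\mathbf a),G)$, $\mathcal H_k(\mathfrak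 A,G)=\varprojlim H_k(\mathbf X_r,G)$, $\mathcal H^k[\mathbb G_\infty(\mathbf a),G]=\varinjlim H^k(\mathbf G_r(\mathbf a),G)$, $\mathcal H^k(\mathfrak A,G)=\varinjlim H^k(\mathbf X_r,G)$. A *proper base ray* for $\mathbf a$ is a continuous $\omega:[0,\infty)\to\mathbb R^D$ with $|\omega(t)|\to\infty$ such that for every $r$ we have $\omega(t)\in\mathbf G_r(\mathbf a)$ for all large $t$. For $k\ge1$, $\pi_k(\mathbf G_r(\mathbf a),\omega)$ is $\pi_k(\mathbf G_r(\mathbf a),\omega(t))$ for any $t$ such that $\omega([t,\infty))\subseteq\mathbf G_r(\mathbf a)$ (different $t$ being identified along $\omega$), and $\pi_k[\mathbb G_\infty(\mathbf a),\omega]=\varprojlim\pi_k(\mathbf G_r(\mathbf a),\omega)$. For $\mathbf c\in\mathfrak A$ let $\pi_k(\mathfrak A,\mathbf c)=\varprojlim\pi_k(\mathbf X_r,x_r(\mathbf c))$. *Basepoint-freeness.* $\mathfrak A$ is *basepoint-free in codimension $k+1$* if one of the following holds: (i) for all large $r$, $\Pi_r$ is injective on the vertices of $\mathbf X_r$ (the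 points over $\mathbb Z^D$); (ii) $(\mathfrak A,\sigma)$ is topologically weakly mixing, $k=1$, and for some $\mathbf c\in\mathfrak A$ the tower $(\pi_1(\mathbf X_r,x_r(\mathbf c)))_{r\ge R}$ is abelian; (iii) $(\mathfrak A,\sigma)$ is topologically weakly mixing and for some $\mathbf c\in\mathfrak A$ the tower $(\pi_1(\mathbf X_r,x_r(\mathbf c)))_{r\ge R}$ is trivial. Here a tower is *abelian* (*trivial*) if for every $r$ there is $s\ge r$ such that the image of the $s$-th group in the $r$-th group is abelian (trivial); for instance if all its groups are. In this case $\pi_k(\mathfrak A)$ denotes $\pi_k(\mathfrak A,\mathbf c)$ for an arbitrary $\mathbf c\in\mathfrak A$. **Theorem.** Let $\mathbf a\in\mathcal A^{\mathbb Z^D}$ be any configuration (for instance one with a defect of projective codimension $k+1$, i.e. with $\pi_k[\mathbb G_\infty(\mathbf a),\omega]$ nontrivial for some proper base ray $\omega$), and let $k\ge 0$. (a) For every abelian group $G$ there are unique homomorphisms $\mathcal H_k\mathbf a:\mathcal H_k[\mathbb G_\infty(\mathbf a),G]\to\mathcal H_k(\mathfrak A,G)$ and $\mathcal H^k\mathbf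 a:\mathcal H^k(\mathfrak A,G)\to\mathcal H^k[\mathbb G_\infty(\mathbf a),G]$ that are given for each $r\ge R$ by the homomorphisms $H_k(\varsigma^r_{\mathbf a})$ and $H^k(\varsigma^r_{\mathbf a})$. (b) Let $k\ge1$, let $\mathfrak A$ be basepoint-free in codimension $k+1$, let $\omega$ be a proper base ray for $\mathbf a$, and let $\mathbf c\in\mathfrak A$. Then there is a unique homomorphism $\pi_k\mathbf a:\pi_k[\mathbb G_\infty(\mathbf a),\omega]\to\pi_k(\mathfrak A,\mathbf c)=\pi_k(\mathfrak A)$ such that for every $r\ge R$ there is $s_0$ with the following property: for every $s\ge \max(s_0,r)$, every $t$ with $\omega([t,\infty))\subseteq\mathbf G_s(\mathbf a)$, every path $\gamma$ in $\mathbf X_s$ from $\varsigma^s_{\mathbf a}(\omega(t))$ to $x_s(\mathbf c)$, and every $\alpha$ with component $\alpha_{s,t}\in\pi_k(\mathbf G_s(\mathbf a),\omega(t))$, the change of basepoint along $\zeta\circ\gamma$ takes $(\zeta\circ\varsigma^s_{\mathbf a})_*\alpha_{s,t}$ to the component of $\pi_k\mathbf a(\alpha)$ in $\pi_k(\mathbf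 X_r,x_r(\mathbf c))$. (c) Let $\Phi:\mathcal A^{\mathbb Z^D}\to\mathcal A^{\mathbb Z^D}$ be a cellular automaton with $\Phi(\mathfrak A)\subseteq\mathfrak A$, and let $\mathbf b=\Phi(\mathbf a)$. For every radius $q$ of $\Phi$ and every $r$, we have $\mathbf G_{r+q}(\mathbf a)\subseteq\mathbf G_r(\mathbf b)$, and $\Phi$ induces a map $\Phi_*:\mathbf X_{r+q}\to\mathbf X_r$ sending the cube $(\mathsf z,\mathbf c|_{\mathbb B(r+q)})$ identically to $(\mathsf z,\Phi(\mathbf c)|_{\mathbb B(r)})$ for $\mathbf c\in\mathfrak A$. There are unique homomorphisms $\mathcal H_k\iota:\mathcal H_k[\mathbb G_\infty(\mathbf a),G]\to\mathcal H_k[\mathbb G_\infty(\mathbf b),G]$ and $\mathcal H^k\iota:\mathcal H^k[\mathbb G_\infty(\mathbf b),G]\to\mathcal H^k[\mathbb G_\infty(\mathbf a),G]$ induced by these inclusions, and unique endomorphisms $\mathcal H_k\Phi$ of $\mathcal H_k(\mathfrak A,G)$ and $\mathcal H^k\Phi$ of $\mathcal H^k(\mathfrak A,G)$ induced by these maps $\Phi_*$,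 and $$\mathcal H_k\mathbf b\circ\mathcal H_k\iota=\mathcal H_k\Phi\circ\mathcal H_k\mathbf a,\qquad \mathcal H^k\iota\circ\mathcal H^k\mathbf b=\mathcal H^k\mathbf a\circ\mathcal H^k\Phi .$$ Under the hypotheses of (b), $\omega$ is also a proper base ray for $\mathbf b$; there is a unique homomorphism $\pi_k\iota:\pi_k[\mathbb G_\infty(\mathbf a),\omega]\to\pi_k[\mathbb G_\infty(\mathbf b),\omega]$ induced by the inclusions; for all $\mathbf c,\mathbf c'\in\mathfrak A$ there is a unique homomorphism $\pi_k\Phi:\pi_k(\mathfrak A,\mathbf c)\to\pi_k(\mathfrak A,\mathbf c')$ induced by the maps $\Phi_*$ followed by changes of basepoint from $x_s(\Phi(\mathbf c))$ to $x_s(\mathbf c')$ along arbitrary paths in $\mathbf X_s$ (with $s$ large, then projected to $\mathbf X_r$, as in (b)); and $\pi_k\mathbf b\circ\pi_k\iota=\pi_k\Phi\circ\pi_k\mathbf a$. -/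

import Mathlib

open CategoryTheory
open scoped Topology unitInterval NNReal Topology.Homotopy

noncomputable section

namespace DefectSignature

/-! ### Configurations, subshifts, cellular automata -/

/-- The lattice `ℤ^D`. -/
abbrev Lat (D : ℕ) : Type := Fin D → ℤ

/-- Configurations `𝒜^{ℤ^D}`. -/
abbrev Config (A : Type) (D : ℕ) : Type := Lat D → A

/-- The shift by `v`: `(σ^v a)_z = a_{z+v}`. -/
def shift {A : Type} {D : ℕ} (v : Lat D) (a : Config A D) : Config A D := fun z => a (z + v)

/-- The box `𝔹(r) = [-r...r]^D`. -/
abbrev Box (D r : ℕ) : Type := {u : Lat D // ∀ i, |u i| ≤ (r : ℤ)}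

/-- Patterns of shape `𝔹(r)`. -/
abbrev Block (A : Type) (D r : ℕ) : Type := Box D r → A

/-- The pattern `a_{z+𝔹(r)}`, regarded as a pattern of shape `𝔹(r)`. -/
def block {A : Type} {D : ℕ} (a : Config A D) (z : Lat D) (r : ℕ) : Block A D r :=
  fun u => a (z + u.1)

/-- The set of admissible `r`-blocks of `S`. -/
def Adm {A : Type} {D : ℕ} (S : Set (Config A D)) (r : ℕ) : Set (Block A D r) :=
  (fun c => block c 0 r) '' S

/-- `S` is a subshift of finite type of radius `R`: it consists of exactly the configurations
all of whose `R`-blocks are admissible.  (Such a set is automatically closed and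
shift-invariant.) -/
def IsSFT {A : Type} {D : ℕ} (S : Set (Config A D)) (R : ℕ) : Prop :=
  S = {a | ∀ z, block a z R ∈ Adm S R}

/-- A cellular automaton: a continuous self-map of `𝒜^{ℤ^D}` commuting with all shifts. -/
structure IsCellularAutomaton {A : Type} [TopologicalSpace A] {D : ℕ}
    (Φ : Config A D → Config A D) : Prop where
  continuous : Continuous Φ
  comm : ∀ v a, Φ (shift v a) = shift v (Φ a)

/-- `Φ` has radius `q`: the value `Φ(a)_z` depends only on `a_{z+𝔹(q)}`. -/
def HasRadius {A : Type} {D : ℕ} (Φ : Config A D → Config A D) (q : ℕ) : Prop :=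
  ∀ a b z, block a z q = block b z q → Φ a z = Φ b z

/-- Topological weak mixing of `(S, σ)`: the product system `(S × S, σ × σ)` is topologically
transitive. -/
def WeaklyMixing {A : Type} [TopologicalSpace A] {D : ℕ} (S : Set (Config A D)) : Prop :=
  ∀ U V : Set (Config A D × Config A D), IsOpen U → IsOpen V →
    (U ∩ S ×ˢ S).Nonempty → (V ∩ S ×ˢ S).Nonempty →
    ∃ z : Lat D, ∃ p ∈ U ∩ S ×ˢ S, (shift z p.1, shift z p.2) ∈ V

/-! ### The unflawed region and its geometric realization -/

/-- The range-`r` unflawed region `𝔾_r(a)`: all sites around which the `r`-block of `a` is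
admissible.  Since restrictions of admissible blocks are admissible, this is the set where the
defect field `z ↦ max {r | a_{𝔹(z,r)} admissible}` is at least `r`. -/
def unflawed {A : Type} {D : ℕ} (S : Set (Config A D)) (a : Config A D) (r : ℕ) :
    Set (Lat D) :=
  {z | block a z r ∈ Adm S r}

/-- The closed unit cube with minimal corner `z`. -/
def unitCube {D : ℕ} (z : Lat D) : Set (Fin D → ℝ) :=
  {x | ∀ i, (z i : ℝ) ≤ x i ∧ x i ≤ z i + 1}

/-- The corner points of `unitCube z`. -/
def corners {D : ℕ} (z : Lat D) : Set (Lat D) := {y | ∀ i, y i = z i ∨ y i = z i + 1}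

/-- The union of all unit cubes whose corners lie in `Y`. -/
def realization {D : ℕ} (Y : Set (Lat D)) : Set (Fin D → ℝ) :=
  ⋃ z ∈ {z : Lat D | corners z ⊆ Y}, unitCube z

/-- The space `𝐆_r(a)`: the realization of the unflawed region of range `r`. -/
abbrev Unflawed {A : Type} {D : ℕ} (S : Set (Config A D)) (a : Config A D) (r : ℕ) : Type :=
  realization (unflawed S a r)

/-! ### Tile complexes -/

/-- The disjoint union of one unit cube for each site of the lattice and each tile. -/
abbrev PreComplex (D : ℕ) (W : Type) : Type := Σ p : Lat D × W, unitCube p.1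

/-- The elementary gluings.  `M d w w'` says that the upper face of `w` in direction `d` is
compatible with the lower face of `w'`.  The cubes `(z, w)` and `(z + e_d, w')` are glued along
their common face when `M d w w'` holds. -/
def Glue {D : ℕ} {W : Type} (M : Fin D → W → W → Prop) (p q : PreComplex D W) : Prop :=
  ∃ d, q.1.1 = p.1.1 + Pi.single d 1 ∧ M d p.1.2 q.1.2 ∧
    (p.2 : Fin D → ℝ) = (q.2 : Fin D → ℝ)

/-- The tile complex of a set of Wang tiles: the quotient space by the equivalence relation
generated by all gluings. -/
def TileComplex {D : ℕ} {W : Type} (M : Fin D → W → W → Prop) : Type := Quot (Glue M)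

instance {D : ℕ} {W : Type} (M : Fin D → W → W → Prop) : TopologicalSpace (TileComplex M) :=
  inferInstanceAs (TopologicalSpace (Quot (Glue M)))

/-- The point of the tile complex lying in the cube labelled `(z, w)` over `x`. -/
def TileComplex.mk {D : ℕ} {W : Type} (M : Fin D → W → W → Prop) (z : Lat D) (w : W)
    (x : unitCube z) : TileComplex M :=
  Quot.mk _ ⟨(z, w), x⟩

theorem TileComplex.continuous_mk {D : ℕ} {W : Type} (M : Fin D → W → W → Prop) (z : Lat D)
    (w : W) : Continuous (TileComplex.mk M z w) :=
  continuous_quot_mk.comp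
    (@continuous_sigmaMk (Lat D × W) (fun p => unitCube p.1) _ (z, w))

/-- The projection `Π` of the tile complex onto `ℝ^D`. -/
def TileComplex.proj {D : ℕ} {W : Type} (M : Fin D → W → W → Prop) :
    C(TileComplex M, Fin D → ℝ) where
  toFun := Quot.lift (fun p => (p.2 : Fin D → ℝ)) (fun _ _ h => h.choose_spec.2.2)
  continuous_toFun := continuous_quot_lift _
    (continuous_sigma fun _ => continuous_subtype_val)

/-- The map of tile complexes induced by a map of tiles that respects matching: the cube
`(z, w)` is mapped identically to the cube `(z, f w)`. -/
def TileComplex.map {D : ℕ} {W W' : Type} {M : Fin D → W → W → Prop}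
    {M' : Fin D → W' → W' → Prop} (f : W → W')
    (hf : ∀ d w w', M d w w' → M' d (f w) (f w')) : C(TileComplex M, TileComplex M') where
  toFun := Quot.lift (fun p => TileComplex.mk M' p.1.1 (f p.1.2) p.2) (by
    rintro p q ⟨d, h1, h2, h3⟩
    exact Quot.sound ⟨d, h1, hf d _ _ h2, h3⟩)
  continuous_toFun := continuous_quot_lift _
    (continuous_sigma fun p => TileComplex.continuous_mk M' p.1 (f p.2))

/-! ### Wang representations -/

/-- The tiles of the radius-`r` Wang representation: the admissible `r`-blocks. -/
abbrev WangTile {A : Type} {D : ℕ} (S : Set (Config A D)) (r : ℕ) : Type := Adm S r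

/-- The matching rule of the Wang representation: the restriction of `w` to the sites with
`u_d > -r` agrees with the restriction of `w'` to the sites with `u_d < r`, after translation
by `e_d`. -/
def wangMatch {A : Type} {D : ℕ} (S : Set (Config A D)) (r : ℕ) (d : Fin D)
    (w w' : WangTile S r) : Prop :=
  ∀ u v : Box D r, u.1 = v.1 + Pi.single d 1 → w.1 u = w'.1 v

/-- The tile complex `𝐗_r` of the radius-`r` Wang representation of `S`. -/
abbrev WangComplex {A : Type} {D : ℕ} (S : Set (Config A D)) (r : ℕ) : Type :=
  TileComplex (wangMatch S r)

/-- Restriction of `s`-blocks to `r`-blocks, `r ≤ s`. -/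
def restrictBlock {A : Type} {D r s : ℕ} (h : r ≤ s) (w : Block A D s) : Block A D r :=
  fun u => w ⟨u.1, fun i => (u.2 i).trans (by exact_mod_cast h)⟩

theorem restrictBlock_mem {A : Type} {D r s : ℕ} (S : Set (Config A D)) (h : r ≤ s)
    {w : Block A D s} (hw : w ∈ Adm S s) : restrictBlock h w ∈ Adm S r := by
  obtain ⟨c, hc, rfl⟩ := hw
  exact ⟨c, hc, rfl⟩

theorem unflawed_anti {A : Type} {D r s : ℕ} (S : Set (Config A D)) (a : Config A D)
    (h : r ≤ s) : unflawed S a s ⊆ unflawed S a r :=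
  fun _ hz => restrictBlock_mem S h hz

theorem realization_mono {D : ℕ} {Y Z : Set (Lat D)} (h : Y ⊆ Z) :
    realization Y ⊆ realization Z :=
  Set.biUnion_subset_biUnion_left fun _ hz => Set.Subset.trans hz h

/-- The inclusion `𝐆_s(a) ⊆ 𝐆_r(a)` for `r ≤ s`. -/
def unflawedIncl {A : Type} {D r s : ℕ} (S : Set (Config A D)) (a : Config A D) (h : r ≤ s) :
    C(Unflawed S a s, Unflawed S a r) :=
  ⟨Set.inclusion (realization_mono (unflawed_anti S a h)), continuous_inclusion _⟩

/-- The map `ζ : 𝐗_s → 𝐗_r`, `r ≤ s`, which restricts the label of every cube from an `s`-block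
to an `r`-block. -/
def zeta {A : Type} {D r s : ℕ} (S : Set (Config A D)) (h : r ≤ s) :
    C(WangComplex S s, WangComplex S r) :=
  TileComplex.map (fun w => ⟨restrictBlock h w.1, restrictBlock_mem S h w.2⟩)
    (fun _ _ _ hm u v huv => hm ⟨u.1, _⟩ ⟨v.1, _⟩ huv)

/-- The base vertex `x_r(c)` of `𝐗_r` determined by `c ∈ S`: the corner over `0` of the cube
at `0` labelled by the central `r`-block of `c`. -/
def baseVertex {A : Type} {D : ℕ} {S : Set (Config A D)} (c : S) (r : ℕ) : WangComplex S r :=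
  TileComplex.mk _ 0 ⟨block c.1 0 r, c.1, c.2, rfl⟩ ⟨0, fun i => by simp⟩

theorem zeta_baseVertex {A : Type} {D r s : ℕ} {S : Set (Config A D)} (h : r ≤ s) (c : S) :
    zeta S h (baseVertex c s) = baseVertex c r := rfl

/-! #### The section determined by a configuration -/

/-- The point over `x` in the cube at `z` labelled by the block of `a` around `z`. -/
def sectionPt {A : Type} {D r : ℕ} {S : Set (Config A D)} {a : Config A D} {x : Fin D → ℝ}
    (z : Lat D) (hz : z ∈ unflawed S a r) (hx : x ∈ unitCube z) : WangComplex S r :=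
  TileComplex.mk _ z ⟨block a z r, hz⟩ ⟨x, hx⟩

theorem sectionPt_step {A : Type} {D r : ℕ} {S : Set (Config A D)} {a : Config A D}
    {x : Fin D → ℝ} {z z' : Lat D} (d : Fin D) (h : z' = z + Pi.single d 1)
    (hz : z ∈ unflawed S a r) (hx : x ∈ unitCube z)
    (hz' : z' ∈ unflawed S a r) (hx' : x ∈ unitCube z') :
    sectionPt z hz hx = sectionPt z' hz' hx' := by
  refine Quot.sound ⟨d, h, ?_, rfl⟩
  intro u v huv
  simp only [block, h, huv]
  congr 1
  abel

theorem sectionPt_path {A : Type} {D r : ℕ} {S : Set (Config A D)} {a : Config A D}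
    {x : Fin D → ℝ} (z : Lat D) (hc : corners z ⊆ unflawed S a r) (hx : x ∈ unitCube z)
    (T : Finset (Fin D)) (hT : ∀ i ∈ T, x i = z i + 1) (z' : Lat D)
    (hz' : z' = fun i => z i + if i ∈ T then 1 else 0) :
    ∃ (hz : z ∈ unflawed S a r) (hu : z' ∈ unflawed S a r) (hx' : x ∈ unitCube z'),
      sectionPt z hz hx = sectionPt z' hu hx' := by
  have hz : z ∈ unflawed S a r := hc fun i => Or.inl rfl
  induction T using Finset.induction_on generalizing z' with
  | empty =>
    obtain rfl : z' = z := by simpa using hz'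
    exact ⟨hz, hz, hx, rfl⟩
  | insert d T hd ih =>
    obtain ⟨_, hu, hx', he⟩ := ih (fun i hi => hT i (Finset.mem_insert_of_mem hi))
      (fun i => z i + if i ∈ T then 1 else 0) rfl
    have hstep : z' = (fun i => z i + if i ∈ T then 1 else 0) + Pi.single d 1 := by
      rw [hz']
      funext i
      by_cases hi : i = d
      · subst hi
        simp [hd]
      · simp [hi]
    have hu' : z' ∈ unflawed S a r := by
      refine hc fun i => ?_
      rw [hz']
      by_cases hi : i ∈ insert d T
      · right
        simp only [hi, if_true]
      · left
        simp only [hi, if_false, add_zero]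
    have hx'' : x ∈ unitCube z' := by
      intro i
      rw [hz']
      by_cases hi : i ∈ insert d T
      · have := hT i hi
        simp only [hi, if_true]
        push_cast
        constructor <;> linarith
      · have := hx i
        simpa only [hi, if_false, add_zero] using this
    exact ⟨hz, hu', hx'', he.trans (sectionPt_step d hstep hu hx' hu' hx'')⟩

theorem sectionPt_eq {A : Type} {D r : ℕ} {S : Set (Config A D)} {a : Config A D}
    {x : Fin D → ℝ} {z z' : Lat D} (hc : corners z ⊆ unflawed S a r)
    (hc' : corners z' ⊆ unflawed S a r) (hx : x ∈ unitCube z) (hx' : x ∈ unitCube z')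
    (hz : z ∈ unflawed S a r) (hz' : z' ∈ unflawed S a r) :
    sectionPt z hz hx = sectionPt z' hz' hx' := by
  have key : ∀ (y y' : Lat D), x ∈ unitCube y → x ∈ unitCube y' →
      (∀ i ∈ Finset.univ.filter (fun i => y i < y' i), x i = y i + 1) ∧
      (fun i => max (y i) (y' i)) =
        fun i => y i + if i ∈ Finset.univ.filter (fun i => y i < y' i) then 1 else 0 := by
    intro y y' hy hy'
    have hle : ∀ i, y' i ≤ y i + 1 := fun i => by
      have h1 := (hy i).2
      have h2 := (hy' i).1
      exact_mod_cast h2.trans h1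
    refine ⟨fun i hi => ?_, ?_⟩
    · have hlt : y i < y' i := by simpa using hi
      have : (y i : ℝ) + 1 ≤ y' i := by exact_mod_cast hlt
      exact le_antisymm (hy i).2 (this.trans (hy' i).1)
    · funext i
      by_cases hlt : y i < y' i
      · have := hle i
        simp only [Finset.mem_filter, Finset.mem_univ, true_and, hlt, if_true]
        omega
      · simp only [Finset.mem_filter, Finset.mem_univ, true_and, hlt, if_false]
        omega
  obtain ⟨h1, h2⟩ := key z z' hx hx'
  obtain ⟨h1', h2'⟩ := key z' z hx' hx
  have hmax : (fun i => max (z i) (z' i)) = fun i => max (z' i) (z i) := by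
    funext i
    exact max_comm _ _
  obtain ⟨_, _, _, e⟩ := sectionPt_path z hc hx _ h1 _ h2
  obtain ⟨_, _, _, e'⟩ := sectionPt_path z' hc' hx' _ h1' _ (hmax.trans h2')
  exact e.trans e'.symm

theorem locallyFinite_unitCube {D : ℕ} : LocallyFinite fun z : Lat D => unitCube z := by
  intro x
  refine ⟨Metric.ball x 1, Metric.ball_mem_nhds x one_pos, ?_⟩
  refine (Set.Finite.pi' fun i : Fin D =>
    Set.finite_Icc (⌊x i⌋ - 3) (⌊x i⌋ + 3)).subset ?_
  rintro z ⟨y, hy, hyx⟩ i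
  have h1 : |y i - x i| < 1 := by
    have := (dist_le_pi_dist y x i).trans_lt hyx
    rwa [Real.dist_eq] at this
  have h2 := hy i
  have h3 := Int.floor_le (x i)
  have h4 := Int.lt_floor_add_one (x i)
  rw [abs_lt] at h1
  constructor
  · have : ((⌊x i⌋ - 3 : ℤ) : ℝ) ≤ z i := by push_cast; linarith
    exact_mod_cast this
  · have : (z i : ℝ) ≤ ((⌊x i⌋ + 3 : ℤ) : ℝ) := by push_cast; linarith
    exact_mod_cast this

theorem isClosed_unitCube {D : ℕ} (z : Lat D) : IsClosed (unitCube z) := by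
  have : unitCube z = ⋂ i, {x : Fin D → ℝ | (z i : ℝ) ≤ x i ∧ x i ≤ z i + 1} := by
    ext x
    simp [unitCube]
  rw [this]
  exact isClosed_iInter fun i =>
    (isClosed_le continuous_const (continuous_apply i)).inter
      (isClosed_le (continuous_apply i) continuous_const)

theorem exists_cube {D : ℕ} {Y : Set (Lat D)} (x : realization Y) :
    ∃ z : Lat D, corners z ⊆ Y ∧ x.1 ∈ unitCube z := by
  have := x.2
  simp only [realization, Set.mem_iUnion, Set.mem_ofPred_eq] at this
  obtain ⟨z, h1, h2⟩ := this
  exact ⟨z, h1, h2⟩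

/-- The underlying function of the section `ς^r_a`. -/
def sectionFun {A : Type} {D : ℕ} (S : Set (Config A D)) (a : Config A D) (r : ℕ)
    (x : Unflawed S a r) : WangComplex S r :=
  sectionPt (exists_cube x).choose ((exists_cube x).choose_spec.1 fun _ => Or.inl rfl)
    (exists_cube x).choose_spec.2

/-- On the cube at `z`, the section takes values in the cube labelled by the block of `a`
around `z`. -/
theorem sectionFun_eq {A : Type} {D : ℕ} (S : Set (Config A D)) (a : Config A D) (r : ℕ)
    (x : Unflawed S a r) (z : Lat D) (hc : corners z ⊆ unflawed S a r)
    (hz : z ∈ unflawed S a r) (hx : x.1 ∈ unitCube z) :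
    sectionFun S a r x = TileComplex.mk _ z ⟨block a z r, hz⟩ ⟨x.1, hx⟩ :=
  sectionPt_eq (exists_cube x).choose_spec.1 hc _ hx _ hz

theorem continuous_sectionFun {A : Type} {D : ℕ} (S : Set (Config A D)) (a : Config A D)
    (r : ℕ) : Continuous (sectionFun S a r) := by
  let F : {z : Lat D // corners z ⊆ unflawed S a r} → Set (Unflawed S a r) :=
    fun z => Subtype.val ⁻¹' unitCube z.1
  have hF : LocallyFinite F :=
    (locallyFinite_unitCube.comp_injective Subtype.val_injective).preimage_continuous
      continuous_subtype_val
  refine hF.continuous ?_ (fun z => (isClosed_unitCube z.1).preimage continuous_subtype_val) ?_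
  · refine Set.eq_univ_of_forall fun x => ?_
    obtain ⟨z, h1, h2⟩ := exists_cube x
    exact Set.mem_iUnion.2 ⟨⟨z, h1⟩, h2⟩
  · intro z
    rw [continuousOn_iff_continuous_domRestrict]
    have hz : z.1 ∈ unflawed S a r := z.2 fun _ => Or.inl rfl
    have : (F z).domRestrict (sectionFun S a r) = fun x : F z =>
        TileComplex.mk (wangMatch S r) z.1 ⟨block a z.1 r, hz⟩ ⟨x.1.1, x.2⟩ := by
      funext x
      exact sectionFun_eq S a r x.1 z.1 z.2 hz x.2
    rw [this]
    exact (TileComplex.continuous_mk _ _ _).comp (by fun_prop)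

/-- The continuous section `ς^r_a : 𝐆_r(a) → 𝐗_r` determined by the configuration `a`. -/
def sec {A : Type} {D : ℕ} (S : Set (Config A D)) (a : Config A D) (r : ℕ) :
    C(Unflawed S a r, WangComplex S r) :=
  ⟨sectionFun S a r, continuous_sectionFun S a r⟩

/-! ### Maps induced by a cellular automaton -/

theorem IsCellularAutomaton.image_block {A : Type} [TopologicalSpace A] {D : ℕ}
    {Φ : Config A D → Config A D} (hΦ : IsCellularAutomaton Φ) {q r : ℕ} (hq : HasRadius Φ q)
    {a b : Config A D} {z y : Lat D} {u v : Lat D} (hu : ∀ i, |u i| ≤ (r : ℤ))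
    (hv : ∀ i, |v i| ≤ (r : ℤ))
    (h : ∀ (s t : Box D (r + q)), s.1 - u = t.1 - v → a (z + s.1) = b (y + t.1)) :
    Φ a (z + u) = Φ b (y + v) := by
  have e1 : Φ a (z + u) = Φ (shift (z + u) a) 0 := by
    rw [hΦ.comm]
    simp [shift]
  have e2 : Φ b (y + v) = Φ (shift (y + v) b) 0 := by
    rw [hΦ.comm]
    simp [shift]
  rw [e1, e2]
  apply hq
  funext w
  have hb : ∀ t : Lat D, (∀ i, |t i| ≤ (r : ℤ)) → ∀ i, |(t + w.1) i| ≤ ((r + q : ℕ) : ℤ) := by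
    intro t ht i
    push_cast
    exact (abs_add_le _ _).trans (add_le_add (ht i) (w.2 i))
  have := h ⟨u + w.1, hb u hu⟩ ⟨v + w.1, hb v hv⟩ (by simp)
  simp only [block, shift, zero_add]
  rwa [show w.1 + (z + u) = z + (u + w.1) by abel, show w.1 + (y + v) = y + (v + w.1) by abel]

/-- The `r`-block of `Φ(a)` around `z` is determined by the `(r+q)`-block of `a` around `z`. -/
theorem IsCellularAutomaton.block_eq {A : Type} [TopologicalSpace A] {D : ℕ}
    {Φ : Config A D → Config A D} (hΦ : IsCellularAutomaton Φ) {q : ℕ} (hq : HasRadius Φ q)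
    (r : ℕ) {a b : Config A D} {z y : Lat D} (h : block a z (r + q) = block b y (r + q)) :
    block (Φ a) z r = block (Φ b) y r := by
  funext u
  refine hΦ.image_block hq u.2 u.2 fun s t hst => ?_
  obtain rfl : s = t := Subtype.ext (sub_left_injective hst)
  exact congrFun h s

/-- The map on tiles induced by `Φ`: the central `(r+q)`-block of `c ∈ S` is sent to the central
`r`-block of `Φ(c)`. -/
def tileMap {A : Type} {D : ℕ} {S : Set (Config A D)} {Φ : Config A D → Config A D}
    (hS : Set.MapsTo Φ S S) (q r : ℕ) (w : WangTile S (r + q)) : WangTile S r :=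
  ⟨block (Φ w.2.choose) 0 r, Φ w.2.choose, hS w.2.choose_spec.1, rfl⟩

theorem tileMap_block {A : Type} [TopologicalSpace A] {D : ℕ} {S : Set (Config A D)}
    {Φ : Config A D → Config A D} (hΦ : IsCellularAutomaton Φ) (hS : Set.MapsTo Φ S S) {q : ℕ}
    (hq : HasRadius Φ q) (r : ℕ) (c : S) :
    tileMap hS q r ⟨block c.1 0 (r + q), c.1, c.2, rfl⟩ =
      ⟨block (Φ c.1) 0 r, Φ c.1, hS c.2, rfl⟩ := by
  refine Subtype.ext (hΦ.block_eq hq r ?_)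
  exact (⟨c.1, c.2, rfl⟩ : block c.1 0 (r + q) ∈ Adm S (r + q)).choose_spec.2

/-- The map `Φ_* : 𝐗_{r+q} → 𝐗_r` induced by a cellular automaton of radius `q`. -/
def wangMap {A : Type} [TopologicalSpace A] {D : ℕ} {S : Set (Config A D)}
    {Φ : Config A D → Config A D} (hΦ : IsCellularAutomaton Φ) (hS : Set.MapsTo Φ S S) {q : ℕ}
    (hq : HasRadius Φ q) (r : ℕ) : C(WangComplex S (r + q), WangComplex S r) :=
  TileComplex.map (tileMap hS q r) (by
    intro d w w' hm u v huv
    refine hΦ.image_block hq u.2 v.2 fun s t hst => ?_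
    have hs : s.1 = t.1 + Pi.single d 1 := by
      rw [huv] at hst
      have h2 : s.1 = t.1 - v.1 + (v.1 + Pi.single d 1) := sub_eq_iff_eq_add.1 hst
      rw [h2]
      abel
    have := hm s t hs
    have h1 := congrFun w.2.choose_spec.2 s
    have h2 := congrFun w'.2.choose_spec.2 t
    exact h1.trans (this.trans h2.symm))

theorem wangMap_baseVertex {A : Type} [TopologicalSpace A] {D : ℕ} {S : Set (Config A D)}
    {Φ : Config A D → Config A D} (hΦ : IsCellularAutomaton Φ) (hS : Set.MapsTo Φ S S) {q : ℕ}
    (hq : HasRadius Φ q) (r : ℕ) (c : S) :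
    wangMap hΦ hS hq r (baseVertex c (r + q)) = baseVertex ⟨Φ c.1, hS c.2⟩ r :=
  congrArg (fun w => TileComplex.mk (wangMatch S r) 0 w ⟨0, fun i => by simp⟩)
    (tileMap_block hΦ hS hq r c)

theorem unflawed_subset {A : Type} [TopologicalSpace A] {D : ℕ} {S : Set (Config A D)}
    {Φ : Config A D → Config A D} (hΦ : IsCellularAutomaton Φ) (hS : Set.MapsTo Φ S S) {q : ℕ}
    (hq : HasRadius Φ q) (a : Config A D) (r : ℕ) :
    unflawed S a (r + q) ⊆ unflawed S (Φ a) r := by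
  rintro z ⟨c, hc, he⟩
  exact ⟨Φ c, hS hc, hΦ.block_eq hq r he⟩

/-- The inclusion `ι : 𝐆_{r+q}(a) ⊆ 𝐆_r(Φ(a))`. -/
def defectIncl {A : Type} [TopologicalSpace A] {D : ℕ} {S : Set (Config A D)}
    {Φ : Config A D → Config A D} (hΦ : IsCellularAutomaton Φ) (hS : Set.MapsTo Φ S S) {q : ℕ}
    (hq : HasRadius Φ q) (a : Config A D) (r : ℕ) :
    C(Unflawed S a (r + q), Unflawed S (Φ a) r) :=
  ⟨Set.inclusion (realization_mono (unflawed_subset hΦ hS hq a r)), continuous_inclusion _⟩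

/-! ### Homology and cohomology with coefficients -/

section Homology

universe u

/-- Singular homology `H_k(-; G)`. -/
def homologyFunctor (G : Type u) [AddCommGroup G] (k : ℕ) : TopCat.{0} ⥤ AddCommGrpCat.{u} :=
  (AlgebraicTopology.singularHomologyFunctor.{0} AddCommGrpCat.{u} k).obj (AddCommGrpCat.of G)

/-- Singular cohomology `H^k(-; G)`: the cohomology of the complex `Hom(C_•(-; ℤ), G)`. -/
def cohomologyFunctor (G : Type u) [AddCommGroup G] (k : ℕ) :
    TopCat.{0}ᵒᵖ ⥤ AddCommGrpCat.{u} :=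
  ((AlgebraicTopology.singularChainComplexFunctor.{0} AddCommGrpCat.{u}).obj
      (AddCommGrpCat.of (ULift.{u} ℤ))).op ⋙
    HomologicalComplex.opFunctor _ _ ⋙
    (preadditiveYoneda.obj (AddCommGrpCat.of G)).mapHomologicalComplex _ ⋙
    HomologicalComplex.homologyFunctor _ _ k

/-- The homology group `H_k(X; G)`. -/
abbrev Homology (G : Type u) [AddCommGroup G] (k : ℕ) (X : Type) [TopologicalSpace X] : Type u :=
  (homologyFunctor G k).obj (TopCat.of X)

/-- The homomorphism `H_k(X; G) → H_k(Y; G)` induced by a continuous map. -/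
def homologyMap (G : Type u) [AddCommGroup G] (k : ℕ) {X Y : Type} [TopologicalSpace X]
    [TopologicalSpace Y] (f : C(X, Y)) : Homology G k X →+ Homology G k Y :=
  ((homologyFunctor G k).map (TopCat.ofHom f)).hom

/-- The cohomology group `H^k(X; G)`. -/
abbrev Cohomology (G : Type u) [AddCommGroup G] (k : ℕ) (X : Type) [TopologicalSpace X] :
    Type u :=
  (cohomologyFunctor G k).obj (Opposite.op (TopCat.of X))

/-- The homomorphism `H^k(Y; G) → H^k(X; G)` induced by a continuous map `X → Y`. -/
def cohomologyMap (G : Type u) [AddCommGroup G] (k : ℕ) {X Y : Type} [TopologicalSpace X]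
    [TopologicalSpace Y] (f : C(X, Y)) : Cohomology G k Y →+ Cohomology G k X :=
  ((cohomologyFunctor G k).map (TopCat.ofHom f).op).hom

/-- The inverse limit of an inverse system of abelian groups. -/
def invLim {ι : Type} [Preorder ι] (H : ι → Type u) [∀ i, AddCommGroup (H i)]
    (f : ∀ i j, i ≤ j → H j →+ H i) : AddSubgroup (∀ i, H i) where
  carrier := {x | ∀ i j (h : i ≤ j), f i j h (x j) = x i}
  zero_mem' := fun _ _ _ => by simp
  add_mem' := fun hx hy i j h => by simp [hx i j h, hy i j h]
  neg_mem' := fun hx i j h => by simp [hx i j h]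

variable {A : Type} {D : ℕ} (S : Set (Config A D)) (R : ℕ) (a : Config A D)
  (G : Type u) [AddCommGroup G] (k : ℕ)

/-- `H_k[𝔾_∞(a); G]`, the inverse limit of the groups `H_k(𝐆_r(a); G)`, `r ≥ R`. -/
abbrev DefectHomology : Type u :=
  invLim (fun r : Set.Ici R => Homology G k (Unflawed S a r))
    (fun _ _ h => homologyMap G k (unflawedIncl S a h))

/-- `H_k(S; G)`, the inverse limit of the groups `H_k(𝐗_r; G)`, `r ≥ R`. -/
abbrev ShiftHomology : Type u :=
  invLim (fun r : Set.Ici R => Homology G k (WangComplex S r))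
    (fun _ _ h => homologyMap G k (zeta S h))

/-- `H^k[𝔾_∞(a); G]`, the direct limit of the groups `H^k(𝐆_r(a); G)`, `r ≥ R`. -/
abbrev DefectCohomology : Type u :=
  AddCommGroup.DirectLimit (fun r : Set.Ici R => Cohomology G k (Unflawed S a r))
    (fun _ _ h => cohomologyMap G k (unflawedIncl S a h))

/-- `H^k(S; G)`, the direct limit of the groups `H^k(𝐗_r; G)`, `r ≥ R`. -/
abbrev ShiftCohomology : Type u :=
  AddCommGroup.DirectLimit (fun r : Set.Ici R => Cohomology G k (WangComplex S r))
    (fun _ _ h => cohomologyMap G k (zeta S h))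

/-- The canonical map `H^k(𝐆_r(a); G) → H^k[𝔾_∞(a); G]`. -/
def DefectCohomology.of (r : Set.Ici R) :
    Cohomology G k (Unflawed S a r) →+ DefectCohomology S R a G k :=
  AddCommGroup.DirectLimit.of (fun r : Set.Ici R => Cohomology G k (Unflawed S a r))
    (fun _ _ h => cohomologyMap G k (unflawedIncl S a h)) r

/-- The canonical map `H^k(𝐗_r; G) → H^k(S; G)`. -/
def ShiftCohomology.of (r : Set.Ici R) :
    Cohomology G k (WangComplex S r) →+ ShiftCohomology S R G k :=
  AddCommGroup.DirectLimit.of (fun r : Set.Ici R => Cohomology G k (WangComplex S r))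
    (fun _ _ h => cohomologyMap G k (zeta S h)) r

variable {S R a G k}

/-- `f` is the homology signature of `a`: in each range `r` it is induced by the section
`ς^r_a`. -/
def IsHomologySignature (f : DefectHomology S R a G k →+ ShiftHomology S R G k) : Prop :=
  ∀ (x : DefectHomology S R a G k) (r : Set.Ici R),
    (f x).1 r = homologyMap G k (sec S a r) (x.1 r)

/-- `f` is the cohomology signature of `a`: in each range `r` it is induced by the section
`ς^r_a`. -/
def IsCohomologySignature (f : ShiftCohomology S R G k →+ DefectCohomology S R a G k) : Prop :=
  ∀ (r : Set.Ici R) (x : Cohomology G k (WangComplex S r)),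
    f (ShiftCohomology.of S R G k r x) =
      DefectCohomology.of S R a G k r (cohomologyMap G k (sec S a r) x)

/-- The index `r + q`. -/
def addIdx (r : Set.Ici R) (q : ℕ) : Set.Ici R :=
  ⟨r.1 + q, le_trans (show R ≤ r.1 from r.2) (Nat.le_add_right _ _)⟩

variable [TopologicalSpace A] {Φ : Config A D → Config A D}

/-- `f = H_k ι`: in each range it is induced by the inclusion `𝐆_{r+q}(a) ⊆ 𝐆_r(Φ(a))`,
where `q` is any radius of `Φ`. -/
def IsHomologyInclusion (hΦ : IsCellularAutomaton Φ) (hS : Set.MapsTo Φ S S)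
    (f : DefectHomology S R a G k →+ DefectHomology S R (Φ a) G k) : Prop :=
  ∀ (q : ℕ) (hq : HasRadius Φ q) (x : DefectHomology S R a G k) (r : Set.Ici R),
    (f x).1 r = homologyMap G k (defectIncl hΦ hS hq a r) (x.1 (addIdx r q))

/-- `f = H_k Φ`: in each range it is induced by `Φ_* : 𝐗_{r+q} → 𝐗_r`, where `q` is any radius
of `Φ`. -/
def IsHomologyCAMap (hΦ : IsCellularAutomaton Φ) (hS : Set.MapsTo Φ S S)
    (f : ShiftHomology S R G k →+ ShiftHomology S R G k) : Prop :=
  ∀ (q : ℕ) (hq : HasRadius Φ q) (x : ShiftHomology S R G k) (r : Set.Ici R),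
    (f x).1 r = homologyMap G k (wangMap hΦ hS hq r) (x.1 (addIdx r q))

/-- `f = H^k ι`: in each range it is induced by the inclusion `𝐆_{r+q}(a) ⊆ 𝐆_r(Φ(a))`. -/
def IsCohomologyInclusion (hΦ : IsCellularAutomaton Φ) (hS : Set.MapsTo Φ S S)
    (f : DefectCohomology S R (Φ a) G k →+ DefectCohomology S R a G k) : Prop :=
  ∀ (q : ℕ) (hq : HasRadius Φ q) (r : Set.Ici R) (x : Cohomology G k (Unflawed S (Φ a) r)),
    f (DefectCohomology.of S R (Φ a) G k r x) =
      DefectCohomology.of S R a G k (addIdx r q)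
        (cohomologyMap G k (defectIncl hΦ hS hq a r) x)

/-- `f = H^k Φ`: in each range it is induced by `Φ_* : 𝐗_{r+q} → 𝐗_r`. -/
def IsCohomologyCAMap (hΦ : IsCellularAutomaton Φ) (hS : Set.MapsTo Φ S S)
    (f : ShiftCohomology S R G k →+ ShiftCohomology S R G k) : Prop :=
  ∀ (q : ℕ) (hq : HasRadius Φ q) (r : Set.Ici R) (x : Cohomology G k (WangComplex S r)),
    f (ShiftCohomology.of S R G k r x) =
      ShiftCohomology.of S R G k (addIdx r q) (cohomologyMap G k (wangMap hΦ hS hq r) x)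

end Homology

/-! ### Homotopy groups -/

section Homotopy

/-- The class in `π_k(X, x)` of a map from the `k`-cube that sends the boundary to `x`. -/
def piMk {k : ℕ} {X : Type} [TopologicalSpace X] {x : X} (p : Ω^ (Fin k) X x) : π_ k X x :=
  Quotient.mk _ p

theorem piMk_mul {k : ℕ} [NeZero k] {X : Type} [TopologicalSpace X] {x : X} (i : Fin k)
    (p q : Ω^ (Fin k) X x) : piMk p * piMk q = piMk (GenLoop.transAt i q p) :=
  HomotopyGroup.mul_spec

theorem piMk_inv {k : ℕ} [NeZero k] {X : Type} [TopologicalSpace X] {x : X} (i : Fin k)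
    (p : Ω^ (Fin k) X x) : (piMk p)⁻¹ = piMk (GenLoop.symmAt i p) :=
  HomotopyGroup.inv_spec

theorem piMk_one {k : ℕ} [NeZero k] {X : Type} [TopologicalSpace X] {x : X} :
    (1 : π_ k X x) = piMk GenLoop.const :=
  HomotopyGroup.one_def

/-- The map on generalized loops induced by a continuous map. -/
def genLoopMap {N X Y : Type} [TopologicalSpace X] [TopologicalSpace Y] (f : C(X, Y))
    {x : X} {y : Y} (h : f x = y) (p : Ω^ N X x) : Ω^ N Y y :=
  ⟨f.comp p.1, fun u hu => (congrArg f (p.2 u hu)).trans h⟩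

/-- The homomorphism `π_k(X, x) → π_k(Y, y)` induced by a continuous map `f` with `f x = y`. -/
def piMap (k : ℕ) [NeZero k] {X Y : Type} [TopologicalSpace X] [TopologicalSpace Y] (f : C(X, Y))
    {x : X} {y : Y} (h : f x = y) : π_ k X x →* π_ k Y y :=
  MonoidHom.mk'
    (Quotient.map (genLoopMap f h) (fun _ _ H => H.map fun H => H.compContinuousMap f))
    (by
      rintro ⟨p⟩ ⟨q⟩
      have i : Fin k := ⟨0, Nat.pos_of_neZero k⟩
      have e3 : genLoopMap f h (GenLoop.transAt i q p) =
          GenLoop.transAt i (genLoopMap f h q) (genLoopMap f h p) := by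
        apply GenLoop.ext
        intro u
        show f (ite _ _ _) = ite _ _ _
        rw [apply_ite f]
        rfl
      change Quotient.map _ _ (piMk p * piMk q) =
        piMk (genLoopMap f h p) * piMk (genLoopMap f h q)
      rw [piMk_mul i, piMk_mul i, ← e3]
      rfl)

/-- `Transports γ α β`: the change-of-basepoint isomorphism along the path `γ` takes
`α ∈ π_k(X, x)` to `β ∈ π_k(X, y)`, i.e. there is a free homotopy from a representative of `α`
to a representative of `β` during which the boundary of the cube (that is, the basepoint of the
sphere) moves along `γ`. -/
def Transports {k : ℕ} {X : Type} [TopologicalSpace X] {x y : X} (γ : I → X)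
    (α : π_ k X x) (β : π_ k X y) : Prop :=
  ∃ (p : Ω^ (Fin k) X x) (q : Ω^ (Fin k) X y) (H : C(I × (I^ Fin k), X)),
    α = piMk p ∧ β = piMk q ∧
    (∀ u, H (0, u) = p u) ∧ (∀ u, H (1, u) = q u) ∧
    ∀ s, ∀ u ∈ Cube.boundary (Fin k), H (s, u) = γ s

theorem Transports.one {k : ℕ} [NeZero k] {X : Type} [TopologicalSpace X] {x y : X} {γ : I → X}
    (hγ : Continuous γ) (h0 : γ 0 = x) (h1 : γ 1 = y) :
    Transports γ (1 : π_ k X x) (1 : π_ k X y) :=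
  ⟨GenLoop.const, GenLoop.const, ⟨fun z => γ z.1, hγ.comp continuous_fst⟩, piMk_one, piMk_one,
    fun _ => h0, fun _ => h1, fun _ _ _ => rfl⟩

theorem Transports.inv {k : ℕ} [NeZero k] {X : Type} [TopologicalSpace X] {x y : X} {γ : I → X}
    {α : π_ k X x} {β : π_ k X y} (h : Transports γ α β) : Transports γ α⁻¹ β⁻¹ := by
  obtain ⟨p, q, H, rfl, rfl, h0, h1, hb⟩ := h
  have i : Fin k := ⟨0, Nat.pos_of_neZero k⟩
  refine ⟨GenLoop.symmAt i p, GenLoop.symmAt i q,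
    ⟨fun z => H (z.1, fun j => if j = i then unitInterval.symm (z.2 i) else z.2 j), ?_⟩,
    piMk_inv i p, piMk_inv i q, fun u => h0 _, fun u => h1 _, ?_⟩
  · refine H.continuous.comp (continuous_fst.prodMk (continuous_pi fun j => ?_))
    by_cases hj : j = i
    · simp only [hj, if_true]
      fun_prop
    · simp only [hj, if_false]
      fun_prop
  · rintro s u ⟨j, hj⟩
    refine hb s _ ⟨j, ?_⟩
    by_cases hji : j = i
    · subst hji
      simp only [if_true]
      rcases hj with hj | hj
      · right
        simp [hj]
      · left
        simp [hj]
    · simpa only [hji, if_false] using hj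

theorem Transports.mul {k : ℕ} [NeZero k] {X : Type} [TopologicalSpace X] {x y : X} {γ : I → X}
    {α α' : π_ k X x} {β β' : π_ k X y} (h : Transports γ α β) (h' : Transports γ α' β') :
    Transports γ (α * α') (β * β') := by
  obtain ⟨p, q, H, rfl, rfl, h0, h1, hb⟩ := h
  obtain ⟨p', q', H', rfl, rfl, h0', h1', hb'⟩ := h'
  have i : Fin k := ⟨0, Nat.pos_of_neZero k⟩
  refine ⟨GenLoop.transAt i p' p, GenLoop.transAt i q' q,
    ⟨fun z => if (z.2 i : ℝ) ≤ 1 / 2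
      then H' (z.1, Function.update z.2 i (Set.projIcc 0 1 zero_le_one (2 * (z.2 i : ℝ))))
      else H (z.1, Function.update z.2 i (Set.projIcc 0 1 zero_le_one (2 * (z.2 i : ℝ) - 1))),
      ?_⟩,
    piMk_mul i p p', piMk_mul i q q', fun u => ?_, fun u => ?_, ?_⟩
  · refine Continuous.if_le ?_ ?_ (by fun_prop) continuous_const ?_
    · refine H'.continuous.comp (continuous_fst.prodMk (continuous_snd.update i ?_))
      exact continuous_projIcc.comp (by fun_prop)
    · refine H.continuous.comp (continuous_fst.prodMk (continuous_snd.update i ?_))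
      exact continuous_projIcc.comp (by fun_prop)
    · intro z hz
      rw [hz, hb' _ _ ⟨i, Or.inr ?_⟩, hb _ _ ⟨i, Or.inl ?_⟩]
      · rw [Function.update_self]
        norm_num
      · rw [Function.update_self]
        norm_num
  · show ite _ _ _ = ite _ _ _
    rw [h0, h0']
  · show ite _ _ _ = ite _ _ _
    rw [h1, h1']
  · rintro s u ⟨j, hj⟩
    show (if (u i : ℝ) ≤ 1 / 2
      then H' (s, Function.update u i (Set.projIcc 0 1 zero_le_one (2 * (u i : ℝ))))
      else H (s, Function.update u i (Set.projIcc 0 1 zero_le_one (2 * (u i : ℝ) - 1)))) = γ s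
    by_cases hji : j = i
    · subst hji
      rcases hj with hj | hj
      · rw [if_pos (by rw [hj]; norm_num)]
        refine hb' s _ ⟨j, Or.inl ?_⟩
        rw [Function.update_self, hj]
        norm_num
      · rw [if_neg (by rw [hj]; norm_num)]
        refine hb s _ ⟨j, Or.inr ?_⟩
        rw [Function.update_self, hj]
        norm_num
    · split_ifs
      · refine hb' s _ ⟨j, ?_⟩
        rwa [Function.update_of_ne hji]
      · refine hb s _ ⟨j, ?_⟩
        rwa [Function.update_of_ne hji]

variable {A : Type} {D : ℕ} (S : Set (Config A D)) (R : ℕ) (a : Config A D) (k : ℕ)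

/-! #### The homotopy groups of a subshift of finite type -/

/-- `π_k(S, c)`: the inverse limit of the groups `π_k(𝐗_r, x_r(c))`, `r ≥ R`. -/
def ShiftHomotopy [NeZero k] (c : S) :
    Subgroup (∀ r : Set.Ici R, π_ k (WangComplex S r) (baseVertex c r)) where
  carrier := {x | ∀ (r s : Set.Ici R) (h : r ≤ s),
    piMap k (zeta S h) (zeta_baseVertex h c) (x s) = x r}
  one_mem' := fun _ _ _ => by simp
  mul_mem' := fun hx hy r s h => by simp [hx r s h, hy r s h]
  inv_mem' := fun hx r s h => by simp [hx r s h]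

/-- Every vertex of the lattice has at most one vertex of `𝐗_r` above it, i.e. the projection
of the `0`-skeleton of `𝐗_r` to `ℤ^D` is injective. -/
def VertexInjective (r : ℕ) : Prop :=
  ∀ (x y : WangComplex S r) (z : Lat D), TileComplex.proj _ x = (fun i => (z i : ℝ)) →
    TileComplex.proj _ y = (fun i => (z i : ℝ)) → x = y

/-- The tower of fundamental groups `π_1(𝐗_r, x_r(c))`, `r ≥ R`, is abelian (as a pro-group):
for every `r` there is `s ≥ r` such that the image of `π_1(𝐗_s)` in `π_1(𝐗_r)` is abelian.
This holds in particular when all the groups `π_1(𝐗_r, x_r(c))` are abelian. -/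
def FundamentalTowerAbelian (c : S) : Prop :=
  ∀ r : Set.Ici R, ∃ (s : Set.Ici R) (h : r ≤ s),
    ∀ g g' : π_ 1 (WangComplex S s) (baseVertex c s),
      piMap 1 (zeta S h) (zeta_baseVertex h c) (g * g') =
        piMap 1 (zeta S h) (zeta_baseVertex h c) (g' * g)

/-- The tower of fundamental groups `π_1(𝐗_r, x_r(c))`, `r ≥ R`, is trivial (as a pro-group):
for every `r` there is `s ≥ r` such that the image of `π_1(𝐗_s)` in `π_1(𝐗_r)` is trivial.
This holds in particular when all the groups `π_1(𝐗_r, x_r(c))` are trivial. -/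
def FundamentalTowerTrivial (c : S) : Prop :=
  ∀ r : Set.Ici R, ∃ (s : Set.Ici R) (h : r ≤ s),
    ∀ g : π_ 1 (WangComplex S s) (baseVertex c s),
      piMap 1 (zeta S h) (zeta_baseVertex h c) g = 1

/-- `S` is basepoint-free in codimension `k + 1`. -/
def BasepointFree [TopologicalSpace A] : Prop :=
  (∃ r₀, ∀ r ≥ r₀, VertexInjective S r) ∨
  (WeaklyMixing S ∧ k = 1 ∧ ∃ c : S, FundamentalTowerAbelian S R c) ∨
  (WeaklyMixing S ∧ ∃ c : S, FundamentalTowerTrivial S R c)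

/-! #### The proper homotopy groups of the unflawed regions -/

/-- A proper base ray for `a`: a continuous path in `ℝ^D` that tends to infinity and that, for
every `r`, eventually stays in `𝐆_r(a)`. -/
structure IsBaseRay (ω : ℝ≥0 → Fin D → ℝ) : Prop where
  continuous : Continuous ω
  tendsto : Filter.Tendsto (fun t => ‖ω t‖) Filter.atTop Filter.atTop
  eventually : ∀ r : ℕ, ∀ᶠ t in Filter.atTop, ω t ∈ realization (unflawed S a r)

/-- The ray `ω` stays in `𝐆_r(a)` from time `t` on. -/
def StaysFrom (ω : ℝ≥0 → Fin D → ℝ) (r : ℕ) (t : ℝ≥0) : Prop :=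
  ∀ t' ≥ t, ω t' ∈ realization (unflawed S a r)

/-- The point `ω(t)` of `𝐆_r(a)`. -/
def rayPt {S : Set (Config A D)} {a : Config A D} {ω : ℝ≥0 → Fin D → ℝ} {r : ℕ} {t : ℝ≥0}
    (h : StaysFrom S a ω r t) : Unflawed S a r :=
  ⟨ω t, h t le_rfl⟩

/-- The segment of the ray `ω` from `ω(t)` to `ω(t')`, as a path in `𝐆_r(a)`. -/
def raySegment {S : Set (Config A D)} {a : Config A D} {ω : ℝ≥0 → Fin D → ℝ} {r : ℕ} {t : ℝ≥0}
    (h : StaysFrom S a ω r t) (t' : ℝ≥0) (u : I) : Unflawed S a r :=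
  ⟨ω (t + unitInterval.toNNReal u * (t' - t)), h _ le_self_add⟩

/-- Pairs `(r, t)` such that `r ≥ R` and the ray stays in `𝐆_r(a)` from time `t` on. -/
structure RayIndex (ω : ℝ≥0 → Fin D → ℝ) where
  /-- the range -/
  r : Set.Ici R
  /-- the time -/
  t : ℝ≥0
  stays : StaysFrom S a ω r t

/-- `π_k[𝔾_∞(a), ω]`: the inverse limit of the groups `π_k(𝐆_r(a), ω)`, `r ≥ R`.  The group
`π_k(𝐆_r(a), ω)` is `π_k(𝐆_r(a), ω(t))` for any `t` such that `ω` stays in `𝐆_r(a)` from time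
`t` on, where the groups for different `t` are identified by moving the basepoint along `ω`.
Thus an element is a family of `α_{r,t} ∈ π_k(𝐆_r(a), ω(t))` such that, for `r ≤ s` and
`t ≤ t'`, moving the basepoint of `α_{r,t}` along `ω` from `ω(t)` to `ω(t')` gives the image of
`α_{s,t'}` under the inclusion `𝐆_s(a) ⊆ 𝐆_r(a)`. -/
def DefectHomotopy [NeZero k] {ω : ℝ≥0 → Fin D → ℝ} (hω : Continuous ω) :
    Subgroup (∀ i : RayIndex S R a ω, π_ k (Unflawed S a i.r) (rayPt i.stays)) where
  carrier := {x | ∀ (i j : RayIndex S R a ω) (h : i.r ≤ j.r), i.t ≤ j.t →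
    Transports (raySegment i.stays j.t) (x i)
      (piMap k (unflawedIncl S a h) (x := rayPt j.stays) rfl (x j))}
  one_mem' := fun i j h ht => by
    rw [Pi.one_apply, Pi.one_apply, map_one]
    refine Transports.one ?_ ?_ ?_
    · unfold raySegment
      fun_prop
    · exact Subtype.ext (by simp [raySegment, rayPt])
    · refine Subtype.ext ?_
      show ω _ = ω _
      simp [add_tsub_cancel_of_le ht]
  mul_mem' := fun hx hy i j h ht => by
    rw [Pi.mul_apply, Pi.mul_apply, map_mul]
    exact (hx i j h ht).mul (hy i j h ht)
  inv_mem' := fun hx i j h ht => by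
    rw [Pi.inv_apply, Pi.inv_apply, map_inv]
    exact (hx i j h ht).inv

/-! #### Signatures and induced maps -/

variable {S R a k} [NeZero k] {ω : ℝ≥0 → Fin D → ℝ} {hω : Continuous ω}

/-- `f` is the homotopy signature `π_k a : π_k[𝔾_∞(a), ω] → π_k(S)`, where `π_k(S)` is computed
with basepoint `c`: it is induced by the sections `ς^s_a`.  More precisely, for every range `r`
and every large enough `s ≥ r`, the component of `f α` in range `r` is obtained by applying
`ς^s_a` to `α_{s,t} ∈ π_k(𝐆_s(a), ω(t))`, moving the basepoint from `ς^s_a(ω(t))` to `x_s(c)`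
along an arbitrary path in `𝐗_s`, and projecting to `𝐗_r`. -/
def IsHomotopySignature (c : S) (f : DefectHomotopy S R a k hω →* ShiftHomotopy S R k c) :
    Prop :=
  ∀ r : Set.Ici R, ∃ s₀ : Set.Ici R, ∀ (j : RayIndex S R a ω) (_ : s₀ ≤ j.r) (h : r ≤ j.r)
    (γ : Path (sec S a j.r (rayPt j.stays)) (baseVertex c j.r)) (α : DefectHomotopy S R a k hω),
    Transports (fun u => zeta S h (γ u))
      (piMap k ((zeta S h).comp (sec S a j.r)) rfl (α.1 j)) ((f α).1 r)

variable [TopologicalSpace A] {Φ : Config A D → Config A D}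

/-- If `ω` stays in `𝐆_{r+q}(a)`, then it stays in `𝐆_r(Φ(a))`. -/
theorem StaysFrom.image (hΦ : IsCellularAutomaton Φ) (hS : Set.MapsTo Φ S S) {q : ℕ}
    (hq : HasRadius Φ q) {r : ℕ} {t : ℝ≥0} (h : StaysFrom S a ω (r + q) t) :
    StaysFrom S (Φ a) ω r t :=
  fun t' ht' => realization_mono (unflawed_subset hΦ hS hq a r) (h t' ht')

/-- `f = π_k ι : π_k[𝔾_∞(a), ω] → π_k[𝔾_∞(Φ(a)), ω]`: in each range it is induced by the inclusion
`𝐆_{r+q}(a) ⊆ 𝐆_r(Φ(a))`, where `q` is any radius of `Φ`. -/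
def IsHomotopyInclusion (hΦ : IsCellularAutomaton Φ) (hS : Set.MapsTo Φ S S)
    (f : DefectHomotopy S R a k hω →* DefectHomotopy S R (Φ a) k hω) : Prop :=
  ∀ (q : ℕ) (hq : HasRadius Φ q) (r : Set.Ici R) (t : ℝ≥0)
    (h : StaysFrom S a ω (addIdx r q) t) (α : DefectHomotopy S R a k hω),
    (f α).1 ⟨r, t, h.image hΦ hS hq⟩ =
      piMap k (defectIncl hΦ hS hq a r) (x := rayPt h) rfl (α.1 ⟨addIdx r q, t, h⟩)

/-- `f = π_k Φ : π_k(S) → π_k(S)`, where the source is computed with basepoint `c` and the target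
with basepoint `c'`: it is the composite of the homomorphism `π_k(S, c) → π_k(S, Φ(c))` induced
by the maps `Φ_* : 𝐗_{r+q} → 𝐗_r`, and the canonical change of basepoint from `Φ(c)` to `c'`.
More precisely, for every range `r` and every large enough `s ≥ r`, the component of `f β` in range
`r` is obtained by applying `Φ_*` to `β_{s+q}`, moving the basepoint from `x_s(Φ(c))` to `x_s(c')`
along an arbitrary path in `𝐗_s`, and projecting to `𝐗_r`. -/
def IsHomotopyCAMap (hΦ : IsCellularAutomaton Φ) (hS : Set.MapsTo Φ S S) (c c' : S)
    (f : ShiftHomotopy S R k c →* ShiftHomotopy S R k c') : Prop :=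
  ∀ (q : ℕ) (hq : HasRadius Φ q) (r : Set.Ici R), ∃ s₀ : Set.Ici R, ∀ (s : Set.Ici R)
    (_ : s₀ ≤ s) (h : r ≤ s) (γ : Path (baseVertex (⟨Φ c, hS c.2⟩ : S) s) (baseVertex c' s))
    (β : ShiftHomotopy S R k c),
    Transports (fun u => zeta S h (γ u))
      (piMap k ((zeta S h).comp (wangMap hΦ hS hq s))
        (congrArg (zeta S h) (wangMap_baseVertex hΦ hS hq s c)) (β.1 (addIdx s q)))
      ((f β).1 r)

end Homotopy

end DefectSignature

end

/-!
Sections of the tile complexes and the maps induced by cellular automata commute with the bonding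
maps, so they pass to the limits; for homology and cohomology this is all. In homotopy, the base
points `ς(ω(t))` and `x_r(c)` differ, and only the free homotopy class of a component is available.
A map whose effect on `π_1` is trivial (or abelian, if `k = 1`) sends freely homotopic elements of
`π_k` to equal ones after any change of basepoint. Basepoint-freeness provides such bonding maps, so
an element of the limit is determined by the free homotopy classes of its components, and these
classes are all that has to be prescribed to define a homomorphism into the limit. Weak mixing makes
the tile complexes path connected. If `Π_r` is injective on vertices, then the subshift is a single
constant configuration and the tile complexes are contractible.
-/

noncomputable section

namespace DefectSignature

/-! ### Change of basepoint in homotopy groups -/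

section Collar

/-- The sup-distance of a point of the cube from the centre, scaled so that the boundary of the cube
is the sphere of radius `1`. -/
def cubeRadius {k : ℕ} (u : I^(Fin k)) : ℝ := ‖fun i => 2 * (u i : ℝ) - 1‖

/-- Dilation of the cube about its centre by the factor `l`, clipped to the cube. -/
def cubeDilate {k : ℕ} (l : ℝ) (u : I^(Fin k)) : I^(Fin k) :=
  fun i => Set.projIcc 0 1 zero_le_one (1 / 2 + ((u i : ℝ) - 1 / 2) * l)

theorem continuous_cubeRadius {k : ℕ} : Continuous (cubeRadius (k := k)) := by
  unfold cubeRadius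
  fun_prop

theorem continuous_cubeDilate {k : ℕ} :
    Continuous fun z : ℝ × (I^(Fin k)) => cubeDilate z.1 z.2 :=
  continuous_pi fun _ => continuous_projIcc.comp (by fun_prop)

theorem cubeRadius_le_one {k : ℕ} (u : I^(Fin k)) : cubeRadius u ≤ 1 := by
  refine (pi_norm_le_iff_of_nonneg zero_le_one).2 fun i => ?_
  rw [Real.norm_eq_abs, abs_le]
  constructor <;> linarith [(u i).2.1, (u i).2.2]

theorem cubeRadius_of_mem_boundary {k : ℕ} {u : I^(Fin k)} (hu : u ∈ Cube.boundary (Fin k)) :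
    cubeRadius u = 1 := by
  refine le_antisymm (cubeRadius_le_one u) ?_
  obtain ⟨i, hi⟩ := hu
  refine le_trans ?_ (norm_le_pi_norm (fun i => 2 * (u i : ℝ) - 1) i)
  rcases hi with hi | hi <;> norm_num [hi]

theorem exists_cubeRadius_eq_abs {k : ℕ} [NeZero k] (u : I^(Fin k)) :
    ∃ i, cubeRadius u = |2 * (u i : ℝ) - 1| := by
  obtain ⟨i, hi⟩ := Finite.exists_max fun i => |2 * (u i : ℝ) - 1|
  exact ⟨i, le_antisymm ((pi_norm_le_iff_of_nonneg (abs_nonneg _)).2 hi)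
    (norm_le_pi_norm (fun i => 2 * (u i : ℝ) - 1) i)⟩

theorem cubeDilate_one {k : ℕ} (u : I^(Fin k)) : cubeDilate 1 u = u := by
  funext i
  simp [cubeDilate, Set.projIcc_val]

theorem cubeDilate_mem_boundary {k : ℕ} [NeZero k] {l : ℝ} {u : I^(Fin k)}
    (hu : cubeRadius u * l = 1) : cubeDilate l u ∈ Cube.boundary (Fin k) := by
  obtain ⟨i, hi⟩ := exists_cubeRadius_eq_abs u
  refine ⟨i, ?_⟩
  rw [hi] at hu
  rcases abs_cases (2 * (u i : ℝ) - 1) with ⟨h, -⟩ | ⟨h, -⟩ <;> rw [h] at hu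
  · exact Or.inr (Set.projIcc_of_right_le _ (by linarith))
  · exact Or.inl (Set.projIcc_of_le_left _ (by linarith))

variable {k : ℕ} {X : Type}

/-- The map on the cube that is `f`, shrunk to the concentric subcube of radius `1 / (1 + s)`, and
that runs along `g` from time `0` to time `s` in the remaining collar of the boundary. -/
def collar (s : I) (f : (I^(Fin k)) → X) (g : I → X) (u : I^(Fin k)) : X :=
  if cubeRadius u * (1 + s) ≤ 1 then f (cubeDilate (1 + s) u)
  else g (Set.projIcc 0 1 zero_le_one (cubeRadius u * (1 + s) - 1))

theorem collar_zero (f : (I^(Fin k)) → X) (g : I → X) : collar 0 f g = f := by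
  funext u
  simp [collar, cubeRadius_le_one, cubeDilate_one]

theorem collar_of_mem_boundary {f : (I^(Fin k)) → X} {g : I → X}
    (hfg : ∀ u ∈ Cube.boundary (Fin k), f u = g 0) (s : I) {u : I^(Fin k)}
    (hu : u ∈ Cube.boundary (Fin k)) : collar s f g u = g s := by
  rcases s.2.1.eq_or_lt with hs | hs
  · obtain rfl : s = 0 := Subtype.ext hs.symm
    rw [collar_zero, hfg u hu]
  · rw [collar, cubeRadius_of_mem_boundary hu, if_neg (by linarith), one_mul,
      add_sub_cancel_left, Set.projIcc_val]

theorem continuous_collar [NeZero k] [TopologicalSpace X] {Z : Type} [TopologicalSpace Z]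
    {s : Z → I} (hs : Continuous s) {f : Z → (I^(Fin k)) → X}
    (hf : Continuous (Function.uncurry f)) {g : Z → I → X} (hg : Continuous (Function.uncurry g))
    (hfg : ∀ z, ∀ u ∈ Cube.boundary (Fin k), f z u = g z 0) :
    Continuous fun z : Z × (I^(Fin k)) => collar (s z.1) (f z.1) (g z.1) z.2 := by
  have hl : Continuous fun z : Z × (I^(Fin k)) => (1 : ℝ) + s z.1 := by fun_prop
  have hr : Continuous fun z : Z × (I^(Fin k)) => cubeRadius z.2 * (1 + s z.1) :=
    (continuous_cubeRadius.comp continuous_snd).mul hl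
  have hp : Continuous fun z : Z × (I^(Fin k)) =>
      Set.projIcc (0 : ℝ) 1 zero_le_one (cubeRadius z.2 * (1 + s z.1) - 1) :=
    continuous_projIcc.comp (hr.sub continuous_const)
  refine Continuous.if_le ?_ (hg.comp (continuous_fst.prodMk hp)) hr continuous_const
    fun z hz => ?_
  · exact hf.comp
      (continuous_fst.prodMk (continuous_cubeDilate.comp (hl.prodMk continuous_snd)))
  · rw [hfg _ _ (cubeDilate_mem_boundary hz), hz, sub_self]
    exact congrArg _ (Set.projIcc_left zero_le_one).symm

end Collar

section Transport

variable {k : ℕ} {X : Type} [TopologicalSpace X] {x y z : X}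

theorem exists_piMk_eq (α : π_ k X x) : ∃ p, piMk p = α := Quotient.exists_rep α

theorem piMk_eq_of_homotopy {p q : Ω^ (Fin k) X x} (H : I → (I^(Fin k)) → X)
    (hH : Continuous (Function.uncurry H)) (h0 : ∀ u, H 0 u = p u) (h1 : ∀ u, H 1 u = q u)
    (hb : ∀ s, ∀ u ∈ Cube.boundary (Fin k), H s u = x) : piMk p = piMk q :=
  Quotient.sound ⟨{
    toFun := Function.uncurry H
    continuous_toFun := hH
    map_zero_left := h0
    map_one_left := h1
    prop' := fun t u hu => (hb t u hu).trans (p.2 u hu).symm }⟩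

theorem Transports.symm {γ : Path x y} {α : π_ k X x} {β : π_ k X y} (h : Transports γ α β) :
    Transports γ.symm β α := by
  obtain ⟨p, q, H, hα, hβ, h0, h1, hb⟩ := h
  exact ⟨q, p, ⟨fun z => H (unitInterval.symm z.1, z.2), by fun_prop⟩, hβ, hα,
    fun u => by simpa using h1 u, fun u => by simpa using h0 u,
    fun s u hu => hb (unitInterval.symm s) u hu⟩

theorem transports_trans_of_homotopy {γ : Path x y} {δ : Path y z} {p : Ω^ (Fin k) X x}
    {q : Ω^ (Fin k) X y} {r : Ω^ (Fin k) X z} {F : ContinuousMap.Homotopy p.1 q.1}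
    {F' : ContinuousMap.Homotopy q.1 r.1}
    (hF : ∀ s, ∀ u ∈ Cube.boundary (Fin k), F (s, u) = γ s)
    (hF' : ∀ s, ∀ u ∈ Cube.boundary (Fin k), F' (s, u) = δ s) :
    Transports (γ.trans δ) (piMk p) (piMk r) := by
  refine ⟨p, r, (F.trans F').toContinuousMap, rfl, rfl, (F.trans F').apply_zero,
    (F.trans F').apply_one, fun s u hu => (F.trans_apply F' (s, u)).trans ?_⟩
  rw [Path.trans_apply]
  split_ifs
  · exact hF _ u hu
  · exact hF' _ u hu

variable [NeZero k]

/-- The free homotopy from `p` to `transportLoop γ p` whose restriction to the boundary of the cube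
runs along `γ`. -/
def transportHomotopy (γ : Path x y) (p : Ω^ (Fin k) X x) : C(I × (I^(Fin k)), X) :=
  ⟨fun v => collar v.1 p γ v.2,
    continuous_collar (s := fun s => s) (f := fun _ => p) (g := fun _ => γ) continuous_id
      (p.1.continuous.comp continuous_snd) (γ.continuous.comp continuous_snd)
      fun _ u hu => (p.2 u hu).trans γ.source.symm⟩

theorem transportHomotopy_zero (γ : Path x y) (p : Ω^ (Fin k) X x) (u : I^(Fin k)) :
    transportHomotopy γ p (0, u) = p u :=
  congrFun (collar_zero p γ) u

theorem transportHomotopy_of_mem_boundary (γ : Path x y) (p : Ω^ (Fin k) X x) (s : I)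
    {u : I^(Fin k)} (hu : u ∈ Cube.boundary (Fin k)) : transportHomotopy γ p (s, u) = γ s :=
  collar_of_mem_boundary (fun u hu => (p.2 u hu).trans γ.source.symm) s hu

/-- The generalized loop obtained from `p` by moving the basepoint along `γ`. -/
def transportLoop (γ : Path x y) (p : Ω^ (Fin k) X x) : Ω^ (Fin k) X y :=
  ⟨(transportHomotopy γ p).curry 1,
    fun _ hu => (transportHomotopy_of_mem_boundary γ p 1 hu).trans γ.target⟩

theorem transports_transportLoop (γ : Path x y) (p : Ω^ (Fin k) X x) :
    Transports γ (piMk p) (piMk (transportLoop γ p)) :=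
  ⟨p, _, transportHomotopy γ p, rfl, rfl, transportHomotopy_zero γ p, fun _ => rfl,
    fun s _ => transportHomotopy_of_mem_boundary γ p s⟩

theorem piMk_transportLoop_refl (p : Ω^ (Fin k) X x) :
    piMk (transportLoop (Path.refl x) p) = piMk p :=
  (piMk_eq_of_homotopy (fun s u => transportHomotopy (Path.refl x) p (s, u))
    (transportHomotopy (Path.refl x) p).continuous (transportHomotopy_zero _ p) (fun _ => rfl)
    fun s _ => transportHomotopy_of_mem_boundary _ p s).symm

theorem piMk_transportLoop_congr {γ γ' : Path x y} (hγ : γ.Homotopic γ') {p p' : Ω^ (Fin k) X x}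
    (hp : piMk p = piMk p') : piMk (transportLoop γ p) = piMk (transportLoop γ' p') := by
  obtain ⟨F⟩ : GenLoop.Homotopic p p' := Quotient.exact hp
  obtain ⟨G⟩ := hγ
  have hFG : ∀ s, ∀ u ∈ Cube.boundary (Fin k), F (s, u) = G (s, 0) := fun s u hu =>
    ((F.eq_fst s hu).trans (p.2 u hu)).trans (G.source s).symm
  refine piMk_eq_of_homotopy (fun s => collar 1 (fun v => F (s, v)) fun v => G (s, v))
    (continuous_collar (f := fun s v => F (s, v)) (g := fun s v => G (s, v)) continuous_const
      F.continuous G.continuous hFG) (fun u => ?_) (fun u => ?_)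
    fun s u hu => (collar_of_mem_boundary (hFG s) 1 hu).trans (G.target s)
  · simp only [ContinuousMap.HomotopyWith.apply_zero]
    rfl
  · simp only [ContinuousMap.HomotopyWith.apply_one]
    rfl

/-- Running the free homotopy up to time `s` and attaching a collar along the rest of `γ`
interpolates between `transportLoop γ p` (at `s = 0`) and the end of the free homotopy. -/
theorem Transports.exists_eq_transportLoop {γ : Path x y} {α : π_ k X x} {β : π_ k X y}
    (h : Transports γ α β) :
    ∃ p : Ω^ (Fin k) X x, α = piMk p ∧ β = piMk (transportLoop γ p) := by
  obtain ⟨p, q, H, hα, rfl, h0, h1, hb⟩ := h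
  have hHγ : ∀ s, ∀ u ∈ Cube.boundary (Fin k), H (s, u) = γ (s ⊔ 0) := fun s u hu => by
    rw [hb s u hu, sup_of_le_left unitInterval.nonneg']
  have hγ0 : (fun v => γ (0 ⊔ v)) = γ := funext fun v =>
    congrArg γ (sup_of_le_right unitInterval.nonneg')
  have hγ1 : (fun v => γ (1 ⊔ v)) = Path.refl y := funext fun v =>
    (congrArg γ (sup_of_le_left unitInterval.le_one')).trans γ.target
  refine ⟨p, hα, ((piMk_eq_of_homotopy
    (fun s => collar 1 (fun v => H (s, v)) fun v => γ (s ⊔ v))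
    (continuous_collar (f := fun s v => H (s, v)) (g := fun s v => γ (s ⊔ v)) continuous_const
      H.continuous (γ.continuous.comp (continuous_fst.sup continuous_snd)) hHγ)
    (fun u => ?_) (fun u => ?_) fun s u hu => ?_).trans (piMk_transportLoop_refl q)).symm⟩
  · simp only [h0, hγ0]
    rfl
  · simp only [h1, hγ1]
    rfl
  · rw [collar_of_mem_boundary (hHγ s) 1 hu, sup_of_le_right unitInterval.le_one', γ.target]

theorem Transports.eq_of_homotopic {γ γ' : Path x y} (hγ : γ.Homotopic γ') {α : π_ k X x}
    {β β' : π_ k X y} (h : Transports γ α β) (h' : Transports γ' α β') : β = β' := by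
  obtain ⟨p, hp, rfl⟩ := h.exists_eq_transportLoop
  obtain ⟨p', hp', rfl⟩ := h'.exists_eq_transportLoop
  exact piMk_transportLoop_congr hγ (hp.symm.trans hp')

theorem exists_transports (γ : Path x y) (α : π_ k X x) : ∃ β : π_ k X y, Transports γ α β := by
  obtain ⟨p, rfl⟩ := exists_piMk_eq α
  exact ⟨_, transports_transportLoop γ p⟩

/-- The change-of-basepoint homomorphism along a path. -/
def piTransport (k : ℕ) [NeZero k] (γ : Path x y) : π_ k X x →* π_ k X y :=
  MonoidHom.mk' (fun α => (exists_transports γ α).choose) fun α β =>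
    Transports.eq_of_homotopic (.refl γ) (exists_transports γ (α * β)).choose_spec
      ((exists_transports γ α).choose_spec.mul (exists_transports γ β).choose_spec)

theorem transports_piTransport (γ : Path x y) (α : π_ k X x) :
    Transports γ α (piTransport k γ α) :=
  (exists_transports γ α).choose_spec

theorem Transports.piTransport_eq {γ : Path x y} {α : π_ k X x} {β : π_ k X y}
    (h : Transports γ α β) : piTransport k γ α = β :=
  (transports_piTransport γ α).eq_of_homotopic (.refl γ) h

theorem transports_iff {γ : Path x y} {α : π_ k X x} {β : π_ k X y} :
    Transports γ α β ↔ piTransport k γ α = β :=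
  ⟨Transports.piTransport_eq, fun h => h ▸ transports_piTransport γ α⟩

theorem piTransport_congr {γ γ' : Path x y} (h : γ.Homotopic γ') (α : π_ k X x) :
    piTransport k γ α = piTransport k γ' α :=
  (transports_piTransport γ α).eq_of_homotopic h (transports_piTransport γ' α)

theorem piTransport_refl (α : π_ k X x) : piTransport k (Path.refl x) α = α := by
  obtain ⟨p, rfl⟩ := exists_piMk_eq α
  exact (transports_transportLoop _ p).piTransport_eq.trans (piMk_transportLoop_refl p)

theorem piTransport_symm_piTransport (γ : Path x y) (α : π_ k X x) :
    piTransport k γ.symm (piTransport k γ α) = α :=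
  (transports_piTransport γ α).symm.piTransport_eq

theorem piTransport_piTransport_symm (γ : Path x y) (α : π_ k X y) :
    piTransport k γ (piTransport k γ.symm α) = α := by
  simpa using piTransport_symm_piTransport γ.symm α

theorem piTransport_trans (γ : Path x y) (δ : Path y z) (α : π_ k X x) :
    piTransport k (γ.trans δ) α = piTransport k δ (piTransport k γ α) := by
  obtain ⟨p, rfl⟩ := exists_piMk_eq α
  rw [(transports_transportLoop γ p).piTransport_eq,
    (transports_transportLoop δ _).piTransport_eq]
  exact Transports.piTransport_eq <| transports_trans_of_homotopy
    (F := ⟨transportHomotopy γ p, transportHomotopy_zero γ p, fun _ => rfl⟩)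
    (F' := ⟨transportHomotopy δ _, transportHomotopy_zero δ _, fun _ => rfl⟩)
    (fun s _ => transportHomotopy_of_mem_boundary γ p s)
    fun s _ => transportHomotopy_of_mem_boundary δ _ s

end Transport

section FreelyHomotopic

variable {k : ℕ} [NeZero k] {X Y Z : Type} [TopologicalSpace X] [TopologicalSpace Y]
  [TopologicalSpace Z]

theorem Transports.map (f : C(X, Y)) {x y : X} {x' y' : Y} (hx : f x = x') (hy : f y = y')
    {γ : I → X} {α : π_ k X x} {β : π_ k X y} (h : Transports γ α β) :
    Transports (fun u => f (γ u)) (piMap k f hx α) (piMap k f hy β) := by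
  obtain ⟨p, q, H, rfl, rfl, h0, h1, hb⟩ := h
  exact ⟨genLoopMap f hx p, genLoopMap f hy q, f.comp H, rfl, rfl, fun u => congrArg f (h0 u),
    fun u => congrArg f (h1 u), fun s u hu => congrArg f (hb s u hu)⟩

theorem piMap_piTransport_of_forall_eq (f : C(X, Y)) {x y : X} {x' y' : Y} (hx : f x = x')
    (hy : f y = y') {γ : Path x y} {γ' : Path x' y'} (h : ∀ u, f (γ u) = γ' u) (α : π_ k X x) :
    piMap k f hy (piTransport k γ α) = piTransport k γ' (piMap k f hx α) :=
  (Transports.piTransport_eq (funext h ▸ (transports_piTransport γ α).map f hx hy)).symm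

theorem piMap_piTransport (f : C(X, Y)) {x y : X} (γ : Path x y) (α : π_ k X x) :
    piMap k f rfl (piTransport k γ α) =
      piTransport k (γ.map f.continuous) (piMap k f rfl α) :=
  piMap_piTransport_of_forall_eq f rfl rfl (fun _ => rfl) α

theorem piMap_piMap (g : C(Y, Z)) (f : C(X, Y)) {x : X} {y : Y} {z : Z} (hf : f x = y)
    (hg : g y = z) (α : π_ k X x) : piMap k g hg (piMap k f hf α) =
      piMap k (g.comp f) ((congrArg g hf).trans hg) α := by
  obtain ⟨p, rfl⟩ := exists_piMk_eq α
  rfl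

theorem piMap_piMap_of_comp_eq {f : C(X, Y)} {g : C(Y, Z)} {p : C(X, Z)} (h : g.comp f = p)
    {x : X} {y : Y} {z : Z} (hf : f x = y) (hg : g y = z) (hp : p x = z) (α : π_ k X x) :
    piMap k g hg (piMap k f hf α) = piMap k p hp α := by
  subst h
  exact piMap_piMap g f hf hg α

theorem piMap_piMap_eq {X' : Type} [TopologicalSpace X'] {f : C(X, Y)} {g : C(Y, Z)}
    {f' : C(X, X')} {g' : C(X', Z)} (h : g.comp f = g'.comp f') {x : X} {y : Y} {y' : X'} {z : Z}
    (hf : f x = y) (hg : g y = z) (hf' : f' x = y') (hg' : g' y' = z) (α : π_ k X x) :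
    piMap k g hg (piMap k f hf α) = piMap k g' hg' (piMap k f' hf' α) :=
  (piMap_piMap_of_comp_eq h hf hg _ α).trans (piMap_piMap g' f' hf' hg' α).symm

/-- Elements of homotopy groups based at possibly different points are freely homotopic if some
change of basepoint takes one to the other. -/
def FreelyHomotopic {x y : X} (α : π_ k X x) (β : π_ k X y) : Prop :=
  ∃ γ : Path x y, piTransport k γ α = β

theorem freelyHomotopic_piTransport {x y : X} (γ : Path x y) (α : π_ k X x) :
    FreelyHomotopic α (piTransport k γ α) :=
  ⟨γ, rfl⟩

namespace FreelyHomotopic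

theorem refl {x : X} (α : π_ k X x) : FreelyHomotopic α α :=
  ⟨.refl x, piTransport_refl α⟩

theorem symm {x y : X} {α : π_ k X x} {β : π_ k X y} (h : FreelyHomotopic α β) :
    FreelyHomotopic β α := by
  obtain ⟨γ, rfl⟩ := h
  exact ⟨γ.symm, piTransport_symm_piTransport γ α⟩

theorem trans {x y z : X} {α : π_ k X x} {β : π_ k X y} {δ : π_ k X z}
    (h : FreelyHomotopic α β) (h' : FreelyHomotopic β δ) : FreelyHomotopic α δ := by
  obtain ⟨γ, rfl⟩ := h
  obtain ⟨γ', rfl⟩ := h'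
  exact ⟨γ.trans γ', piTransport_trans γ γ' α⟩

theorem map (f : C(X, Y)) {x y : X} {x' y' : Y} (hx : f x = x') (hy : f y = y') {α : π_ k X x}
    {β : π_ k X y} (h : FreelyHomotopic α β) :
    FreelyHomotopic (piMap k f hx α) (piMap k f hy β) := by
  obtain ⟨γ, rfl⟩ := h
  subst hx hy
  exact ⟨γ.map f.continuous, (piMap_piTransport f γ α).symm⟩

end FreelyHomotopic

/-- The action of the fundamental groupoid of `X` on `π_k` becomes trivial after applying `f`:
elements with a common basepoint that differ by a change of basepoint have the same image. -/
def ActsTrivially (k : ℕ) [NeZero k] (f : C(X, Y)) : Prop :=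
  ∀ ⦃x : X⦄ ⦃α β : π_ k X x⦄, FreelyHomotopic α β → piMap k f rfl α = piMap k f rfl β

namespace ActsTrivially

theorem piMap_eq {f : C(X, Y)} (hf : ActsTrivially k f) {x : X} {y : Y} (hy : f x = y)
    {α β : π_ k X x} (h : FreelyHomotopic α β) : piMap k f hy α = piMap k f hy β := by
  subst hy
  exact hf h

theorem comp_right {f : C(Y, Z)} (hf : ActsTrivially k f) (g : C(X, Y)) :
    ActsTrivially k (f.comp g) := by
  intro x α β h
  rw [← piMap_piMap f g rfl rfl, ← piMap_piMap f g rfl rfl]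
  exact hf (h.map g rfl rfl)

end ActsTrivially

theorem actsTrivially_of_basepoint [PathConnectedSpace X] {f : C(X, Y)} (x₀ : X)
    (h : ∀ (ℓ : Path x₀ x₀) (α : π_ k X x₀),
      piMap k f rfl (piTransport k ℓ α) = piMap k f rfl α) :
    ActsTrivially k f := by
  rintro x α _ ⟨ℓ, rfl⟩
  let δ : Path x₀ x := PathConnectedSpace.somePath x₀ x
  have hloop := h ((δ.trans ℓ).trans δ.symm) (piTransport k δ.symm α)
  rw [piTransport_trans, piTransport_trans, piTransport_piTransport_symm] at hloop
  have hback := congrArg (piTransport k (δ.map f.continuous)) hloop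
  rw [← piMap_piTransport, ← piMap_piTransport, piTransport_piTransport_symm,
    piTransport_piTransport_symm] at hback
  exact hback.symm

/-- A loop as a one-dimensional generalized loop. -/
def pathLoop {x : X} (ℓ : Path x x) : Ω^ (Fin 1) X x := (genLoopEquivOfUnique (Fin 1)).symm ℓ

theorem pathLoop_surjective {x : X} (p : Ω^ (Fin 1) X x) : ∃ ℓ : Path x x, pathLoop ℓ = p :=
  (genLoopEquivOfUnique (Fin 1)).symm.surjective p

theorem piMk_pathLoop_eq_iff {x : X} {ℓ ℓ' : Path x x} :
    piMk (pathLoop ℓ) = piMk (pathLoop ℓ') ↔ ℓ.Homotopic ℓ' :=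
  (HomotopyGroup.pi1EquivFundamentalGroup (X := X) (x := x)).apply_eq_iff_eq.symm.trans
    Path.Homotopic.Quotient.eq

theorem piMk_pathLoop_mul {x : X} (ℓ ℓ' : Path x x) :
    piMk (pathLoop ℓ) * piMk (pathLoop ℓ') = piMk (pathLoop (ℓ'.trans ℓ)) :=
  piMk_mul default _ _

theorem piMap_pathLoop (f : C(X, Y)) {x : X} (ℓ : Path x x) :
    piMap 1 f rfl (piMk (pathLoop ℓ)) = piMk (pathLoop (ℓ.map f.continuous)) := rfl

theorem actsTrivially_of_trivial [PathConnectedSpace X] {f : C(X, Y)} (x₀ : X)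
    (h : ∀ g : π_ 1 X x₀, piMap 1 f rfl g = 1) : ActsTrivially k f := by
  refine actsTrivially_of_basepoint x₀ fun ℓ α => ?_
  have hℓ : (ℓ.map f.continuous).Homotopic (Path.refl (f x₀)) := by
    refine piMk_pathLoop_eq_iff.1 ?_
    rw [← piMap_pathLoop, h, piMk_one]
    rfl
  rw [piMap_piTransport, piTransport_congr hℓ, piTransport_refl]

theorem homotopic_of_square {x y : X} {p : Path x x} {q : Path y y} {γ : Path x y}
    (H : C(I × I, X)) (h0 : ∀ t, H (0, t) = p t) (h1 : ∀ t, H (1, t) = q t)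
    (hl : ∀ s, H (s, 0) = γ s) (hr : ∀ s, H (s, 1) = γ s) :
    (p.trans γ).Homotopic (γ.trans q) := by
  let F : ContinuousMap.Homotopy p.toContinuousMap q.toContinuousMap := ⟨H, h0, h1⟩
  have hF := (Path.Homotopic.map_trans_evalAt F Path.id).pathCast p.source.symm q.target.symm
  have hpγ : ((Path.id.map p.continuous).trans (F.evalAt 1)).cast p.source.symm q.target.symm =
      p.trans γ := by
    ext t
    simp only [Path.cast_coe, Path.trans_apply]
    split_ifs
    · rfl
    · exact hr _
  have hγq : ((F.evalAt 0).trans (Path.id.map q.continuous)).cast p.source.symm q.target.symm =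
      γ.trans q := by
    ext t
    simp only [Path.cast_coe, Path.trans_apply]
    split_ifs
    · exact hl _
    · rfl
  rwa [← hpγ, ← hγq]

theorem homotopic_of_piTransport_pathLoop {x y : X} (γ : Path x y) (p : Path x x) {q : Path y y}
    (h : piTransport 1 γ (piMk (pathLoop p)) = piMk (pathLoop q)) :
    (p.trans γ).Homotopic (γ.trans q) := by
  obtain ⟨p', q', H, hp, hq, h0, h1, hb⟩ := transports_iff.2 h
  obtain ⟨p', rfl⟩ := pathLoop_surjective p'
  obtain ⟨q', rfl⟩ := pathLoop_surjective q'
  have hsquare : (p'.trans γ).Homotopic (γ.trans q') :=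
    homotopic_of_square (H.comp ⟨fun z => (z.1, fun _ => z.2), by fun_prop⟩)
      (fun _ => h0 _) (fun _ => h1 _) (fun s => hb s _ ⟨0, Or.inl rfl⟩)
      (fun s => hb s _ ⟨0, Or.inr rfl⟩)
  exact ((piMk_pathLoop_eq_iff.1 hp).hcomp (.refl γ)).trans
    (hsquare.trans ((Path.Homotopic.refl γ).hcomp (piMk_pathLoop_eq_iff.1 hq).symm))

theorem mul_piTransport_pathLoop {x : X} (ℓ : Path x x) (α : π_ 1 X x) :
    piTransport 1 ℓ α * piMk (pathLoop ℓ) = piMk (pathLoop ℓ) * α := by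
  obtain ⟨p, rfl⟩ := exists_piMk_eq α
  obtain ⟨p, rfl⟩ := pathLoop_surjective p
  obtain ⟨q, hq⟩ := exists_piMk_eq (piTransport 1 ℓ (piMk (pathLoop p)))
  obtain ⟨q, rfl⟩ := pathLoop_surjective q
  rw [← hq, piMk_pathLoop_mul, piMk_pathLoop_mul]
  exact (piMk_pathLoop_eq_iff.2 (homotopic_of_piTransport_pathLoop ℓ p hq.symm)).symm

theorem actsTrivially_of_abelian [PathConnectedSpace X] {f : C(X, Y)} (x₀ : X)
    (h : ∀ g g' : π_ 1 X x₀, piMap 1 f rfl (g * g') = piMap 1 f rfl (g' * g)) :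
    ActsTrivially 1 f := by
  refine actsTrivially_of_basepoint x₀ fun ℓ α => mul_right_cancel (b := piMap 1 f rfl
    (piMk (pathLoop ℓ))) ?_
  rw [← map_mul, ← map_mul, mul_piTransport_pathLoop, h]

end FreelyHomotopic

/-! ### Inverse limits of homotopy groups -/

section HomotopyLim

variable {ι : Type} [Preorder ι] {X : ι → Type} [∀ i, TopologicalSpace (X i)]
  {ζ : ∀ ⦃i j : ι⦄, i ≤ j → C(X j, X i)} {x : ∀ i, X i}
  {hx : ∀ ⦃i j⦄ (h : i ≤ j), ζ h (x j) = x i} {k : ℕ} [NeZero k]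

/-- The inverse limit of the groups `π_k(X_i, x_i)` of an inverse system `X` of spaces with
compatible basepoints `x_i`. -/
def homotopyLim (k : ℕ) [NeZero k] (hx : ∀ ⦃i j⦄ (h : i ≤ j), ζ h (x j) = x i) :
    Subgroup (∀ i, π_ k (X i) (x i)) where
  carrier := {α | ∀ i j (h : i ≤ j), piMap k (ζ h) (hx h) (α j) = α i}
  one_mem' := fun _ _ _ => by simp
  mul_mem' := fun hα hβ i j h => by simp [hα i j h, hβ i j h]
  inv_mem' := fun hα i j h => by simp [hα i j h]

/-- Some bonding map into each space of the inverse system trivializes the action of the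
fundamental groupoid on `π_k`. -/
def TowerActsTrivially (k : ℕ) [NeZero k] (ζ : ∀ ⦃i j : ι⦄, i ≤ j → C(X j, X i)) : Prop :=
  ∀ i, ∃ (j : ι) (h : i ≤ j), ActsTrivially k (ζ h)

theorem TowerActsTrivially.eventually (htriv : TowerActsTrivially k ζ)
    (hζ : ∀ ⦃i j l⦄ (h : i ≤ j) (h' : j ≤ l), (ζ h).comp (ζ h') = ζ (h.trans h')) (i : ι) :
    ∃ j, i ≤ j ∧ ∀ l (_ : j ≤ l) (h : i ≤ l), ActsTrivially k (ζ h) := by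
  obtain ⟨j, hij, hj⟩ := htriv i
  exact ⟨j, hij, fun l hjl _ => hζ hij hjl ▸ hj.comp_right (ζ hjl)⟩

theorem homotopyLim_ext (htriv : TowerActsTrivially k ζ) {α β : homotopyLim k hx}
    (h : ∀ i, ∃ j, i ≤ j ∧ FreelyHomotopic (α.1 j) (β.1 j)) : α = β := by
  refine Subtype.ext (funext fun i => ?_)
  obtain ⟨j, hij, hj⟩ := htriv i
  obtain ⟨l, hjl, hl⟩ := h j
  have hαβ : FreelyHomotopic (α.1 j) (β.1 j) := by
    rw [← α.2 j l hjl, ← β.2 j l hjl]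
    exact hl.map _ _ _
  rw [← α.2 i j hij, ← β.2 i j hij]
  exact hj.piMap_eq _ hαβ

theorem ActsTrivially.piMap_eq_of_le
    (hζ : ∀ ⦃i j l⦄ (h : i ≤ j) (h' : j ≤ l), (ζ h).comp (ζ h') = ζ (h.trans h')) {i j l : ι}
    {hij : i ≤ j} (hj : ActsTrivially k (ζ hij)) (hjl : j ≤ l) {α : π_ k (X j) (x j)}
    {β : π_ k (X l) (x l)} (h : FreelyHomotopic α (piMap k (ζ hjl) (hx hjl) β)) :
    piMap k (ζ hij) (hx hij) α =
      piMap k (ζ (hij.trans hjl)) (hx (hij.trans hjl)) β := by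
  rw [hj.piMap_eq _ h]
  exact piMap_piMap_of_comp_eq (hζ hij hjl) _ _ _ _

variable {J : Type} [Preorder J] {ρ : J → ι} {L : Type}

theorem exists_hom_homotopyLim [IsDirectedOrder J] [Group L] (hρ : Monotone ρ)
    (hcof : ∀ i, ∃ m, i ≤ ρ m) (htriv : TowerActsTrivially k ζ)
    (hζ : ∀ ⦃i j l⦄ (h : i ≤ j) (h' : j ≤ l), (ζ h).comp (ζ h') = ζ (h.trans h'))
    {φ : ∀ j, L →* π_ k (X (ρ j)) (x (ρ j))}
    (hφ : ∀ ⦃j m⦄ (h : j ≤ m) α, FreelyHomotopic (φ j α) (piMap k (ζ (hρ h)) (hx _) (φ m α))) :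
    ∃ f : L →* homotopyLim k hx, ∀ j α, FreelyHomotopic (φ j α) ((f α).1 (ρ j)) := by
  have hdeep : ∀ i, ∃ m, ∃ h : i ≤ ρ m, ActsTrivially k (ζ h) := fun i => by
    obtain ⟨s, his, hs⟩ := htriv.eventually hζ i
    obtain ⟨m, hm⟩ := hcof s
    exact ⟨m, his.trans hm, hs _ hm _⟩
  choose d hd htrivd using hdeep
  let F : L →* ∀ i, π_ k (X i) (x i) :=
    MonoidHom.pi fun i => (piMap k (ζ (hd i)) (hx (hd i))).comp (φ (d i))
  have hF : ∀ i m (h : d i ≤ m) α, F α i =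
      piMap k (ζ ((hd i).trans (hρ h))) (hx _) (φ m α) := fun i m h α =>
    (htrivd i).piMap_eq_of_le hζ (hρ h) (hφ h α)
  refine ⟨F.codRestrict (homotopyLim k hx) fun α i j hij => ?_, fun j α => ?_⟩
  · obtain ⟨m, hi, hj⟩ := exists_ge_ge (d i) (d j)
    rw [hF i m hi, hF j m hj]
    exact piMap_piMap_of_comp_eq (hζ _ _) _ _ _ _
  · obtain ⟨m, hm, hj⟩ := exists_ge_ge (d (ρ j)) j
    change FreelyHomotopic (φ j α) (F α (ρ j))
    rw [hF (ρ j) m hm]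
    exact hφ hj α

variable {y : ∀ j, X (ρ j)}

theorem existsUnique_hom_homotopyLim [IsDirectedOrder J] [Group L]
    [∀ i, PathConnectedSpace (X i)] (hρ : Monotone ρ) (hcof : ∀ i, ∃ m, i ≤ ρ m)
    (htriv : TowerActsTrivially k ζ)
    (hζ : ∀ ⦃i j l⦄ (h : i ≤ j) (h' : j ≤ l), (ζ h).comp (ζ h') = ζ (h.trans h'))
    {φ : ∀ j, L →* π_ k (X (ρ j)) (y j)}
    (hφ : ∀ ⦃j m⦄ (h : j ≤ m) α, FreelyHomotopic (φ j α) (piMap k (ζ (hρ h)) rfl (φ m α))) :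
    ∃! f : L →* homotopyLim k hx, ∀ j α, FreelyHomotopic (φ j α) ((f α).1 (ρ j)) := by
  let γ : ∀ j, Path (y j) (x (ρ j)) := fun j => PathConnectedSpace.somePath _ _
  have hγ : ∀ j α, FreelyHomotopic (φ j α) (piTransport k (γ j) (φ j α)) := fun j α =>
    freelyHomotopic_piTransport _ _
  obtain ⟨f, hf⟩ := exists_hom_homotopyLim (hx := hx)
    (φ := fun j => (piTransport k (γ j)).comp (φ j)) hρ hcof htriv hζ fun j m h α =>
      ((hγ j α).symm.trans (hφ h α)).trans ((hγ m α).map _ rfl (hx _))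
  refine ⟨f, fun j α => (hγ j α).trans (hf j α), fun g hg => MonoidHom.ext fun α =>
    homotopyLim_ext htriv fun i => ?_⟩
  obtain ⟨m, hm⟩ := hcof i
  exact ⟨ρ m, hm, (hg m α).symm.trans ((hγ m α).trans (hf m α))⟩

theorem Transports.freelyHomotopic {Y : Type} [TopologicalSpace Y] {p q q' : Y} {γ : Path p q}
    (hq : q = q') {α : π_ k Y p} {β : π_ k Y q'} (h : Transports γ α β) :
    FreelyHomotopic α β := by
  subst hq
  exact ⟨γ, h.piTransport_eq⟩

theorem forall_transports_iff_freelyHomotopic [IsDirectedOrder J] [∀ i, PathConnectedSpace (X i)]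
    (hρ : Monotone ρ) (hcof : ∀ i, ∃ m, i ≤ ρ m) (htriv : TowerActsTrivially k ζ)
    (hζ : ∀ ⦃i j l⦄ (h : i ≤ j) (h' : j ≤ l), (ζ h).comp (ζ h') = ζ (h.trans h'))
    {φ : ∀ j, L → π_ k (X (ρ j)) (y j)}
    (hφ : ∀ ⦃j m⦄ (h : j ≤ m) α, FreelyHomotopic (φ j α) (piMap k (ζ (hρ h)) rfl (φ m α)))
    (f : L → homotopyLim k hx) :
    (∀ i, ∃ s, ∀ j, s ≤ ρ j → ∀ (h : i ≤ ρ j) (γ : Path (y j) (x (ρ j))) α,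
      Transports (fun u => ζ h (γ u)) (piMap k (ζ h) rfl (φ j α)) ((f α).1 i)) ↔
    ∀ j α, FreelyHomotopic (φ j α) ((f α).1 (ρ j)) := by
  refine ⟨fun hf j α => ?_, fun hf i => ?_⟩
  · obtain ⟨s, hs⟩ := hf (ρ j)
    obtain ⟨m₀, hm₀⟩ := hcof s
    obtain ⟨m, hm, hjm⟩ := exists_ge_ge m₀ j
    let γ : Path (y m) (x (ρ m)) := PathConnectedSpace.somePath _ _
    exact (hφ hjm α).trans (Transports.freelyHomotopic (γ := γ.map (ζ (hρ hjm)).continuous) (hx _)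
      (hs m (hm₀.trans (hρ hm)) (hρ hjm) γ α))
  · obtain ⟨s, -, hs⟩ := htriv.eventually hζ i
    refine ⟨s, fun j hsj h γ α => ?_⟩
    have hγ : piMap k (ζ h) (hx h) (piTransport k γ (φ j α)) = (f α).1 i :=
      ((hs _ hsj h).piMap_eq _ ((freelyHomotopic_piTransport γ _).symm.trans (hf j α))).trans
        ((f α).2 _ _ h)
    exact hγ ▸ (transports_piTransport γ (φ j α)).map (ζ h) rfl (hx h)

end HomotopyLim

/-! ### Topology of the tile complexes of a subshift -/

section Wang

variable {A : Type} {D : ℕ} {S : Set (Config A D)} {R r : ℕ}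

theorem block_shift (v z : Lat D) (c : Config A D) (r : ℕ) :
    block (shift v c) z r = block c (z + v) r :=
  funext fun u => congrArg c (add_right_comm z u.1 v)

/-- Invariance of a set of configurations under all shifts. -/
def ShiftInvariant (S : Set (Config A D)) : Prop :=
  ∀ v, Set.MapsTo (shift v) S S

theorem IsSFT.shiftInvariant (hS : IsSFT S R) : ShiftInvariant S := by
  intro v c hc
  rw [hS] at hc ⊢
  intro z
  rw [block_shift]
  exact hc _

theorem ShiftInvariant.block_mem (hS : ShiftInvariant S) {c : Config A D} (hc : c ∈ S)
    (z : Lat D) (r : ℕ) : block c z r ∈ Adm S r :=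
  ⟨shift z c, hS z hc, by simp only [block_shift, zero_add]⟩

theorem mem_unitCube_floor (x : Fin D → ℝ) : x ∈ unitCube fun i => ⌊x i⌋ :=
  fun _ => ⟨Int.floor_le _, (Int.lt_floor_add_one _).le⟩

theorem cast_mem_unitCube (z : Lat D) : (fun i => (z i : ℝ)) ∈ unitCube z :=
  fun _ => ⟨le_rfl, by simp⟩

theorem ShiftInvariant.mem_realization (hS : ShiftInvariant S) {c : Config A D} (hc : c ∈ S)
    (r : ℕ) (x : Fin D → ℝ) : x ∈ realization (unflawed S c r) :=
  Set.mem_biUnion (x := fun i => ⌊x i⌋) (fun _ _ => hS.block_mem hc _ r) (mem_unitCube_floor x)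

/-- The section `ℝ^D → 𝐗_r` determined by an admissible configuration. -/
def globalSec (hS : ShiftInvariant S) (c : S) (r : ℕ) : C(Fin D → ℝ, WangComplex S r) :=
  (sec S c.1 r).comp ⟨fun x => ⟨x, hS.mem_realization c.2 r x⟩, by fun_prop⟩

theorem globalSec_apply (hS : ShiftInvariant S) (c : S) (r : ℕ) {x : Fin D → ℝ} {z : Lat D}
    (hx : x ∈ unitCube z) : globalSec hS c r x =
      TileComplex.mk _ z ⟨block c.1 z r, hS.block_mem c.2 z r⟩ ⟨x, hx⟩ :=
  sectionFun_eq S c.1 r _ z (fun _ _ => hS.block_mem c.2 _ r) _ hx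

theorem proj_globalSec (hS : ShiftInvariant S) (c : S) (r : ℕ) (x : Fin D → ℝ) :
    TileComplex.proj _ (globalSec hS c r x) = x := by
  rw [globalSec_apply hS c r (mem_unitCube_floor x)]
  rfl

theorem exists_globalSec_eq (hS : ShiftInvariant S) (p : WangComplex S r) :
    ∃ (c : S) (x : Fin D → ℝ), globalSec hS c r x = p := by
  obtain ⟨⟨⟨z, _, c, hc, rfl⟩, x⟩, rfl⟩ := Quot.exists_rep p
  refine ⟨⟨shift (-z) c, hS _ hc⟩, x, (globalSec_apply hS _ r x.2).trans ?_⟩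
  simp only [block_shift, add_neg_cancel]
  rfl

/-! #### Path connectedness -/

theorem joined_globalSec_of_block_eq (hS : ShiftInvariant S) {c c' : S} {z : Lat D}
    (h : block c.1 z r = block c'.1 z r) (x x' : Fin D → ℝ) :
    Joined (globalSec hS c r x) (globalSec hS c' r x') := by
  have hjoined : ∀ (d : S) (y y' : Fin D → ℝ), Joined (globalSec hS d r y) (globalSec hS d r y') :=
    fun d y y' => ⟨(PathConnectedSpace.somePath y y').map (globalSec hS d r).continuous⟩
  have hz : globalSec hS c r (fun i => z i) = globalSec hS c' r (fun i => z i) := by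
    rw [globalSec_apply hS c r (cast_mem_unitCube z), globalSec_apply hS c' r (cast_mem_unitCube z)]
    simp only [h]
  exact (hz ▸ hjoined c x _).trans (hjoined c' _ x')

instance (D r : ℕ) : Finite (Box D r) :=
  ((Set.Finite.pi' fun _ : Fin D => Set.finite_Icc (-(r : ℤ)) r).subset
    fun u (hu : ∀ i, |u i| ≤ (r : ℤ)) i => abs_le.1 (hu i)).to_subtype

theorem isOpen_setOf_block_eq [TopologicalSpace A] [DiscreteTopology A] (z : Lat D)
    (w : Block A D r) : IsOpen {c : Config A D | block c z r = w} :=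
  (isOpen_discrete {w}).preimage (continuous_pi fun u => continuous_apply (z + u.1))

theorem WeaklyMixing.joined_globalSec [TopologicalSpace A] [DiscreteTopology A]
    (hM : WeaklyMixing S) (hS : ShiftInvariant S) (c c' : S) (x x' : Fin D → ℝ) :
    Joined (globalSec hS c r x) (globalSec hS c' r x') := by
  have ho := fun b : S => isOpen_setOf_block_eq (r := r) 0 (block b.1 0 r)
  obtain ⟨z, ⟨d, d'⟩, ⟨⟨hd, hd'⟩, hdS, hdS'⟩, hz, hz'⟩ := hM _ _ ((ho c).prod (ho c))
    ((ho c).prod (ho c')) ⟨(c.1, c.1), ⟨rfl, rfl⟩, c.2, c.2⟩ ⟨(c.1, c'.1), ⟨rfl, rfl⟩, c.2, c'.2⟩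
  have hdd' : block (shift z d) (-z) r = block (shift z d') (-z) r := by
    rw [block_shift, block_shift, neg_add_cancel]
    exact hd.trans hd'.symm
  let e : S := ⟨shift z d, hS z hdS⟩
  let e' : S := ⟨shift z d', hS z hdS'⟩
  exact (joined_globalSec_of_block_eq (c' := e) hS hz.symm x x).trans
    ((joined_globalSec_of_block_eq (c := e) (c' := e') hS hdd' x x').trans
      (joined_globalSec_of_block_eq (c := e') (c' := c') hS hz' x' x'))

theorem WeaklyMixing.pathConnectedSpace [TopologicalSpace A] [DiscreteTopology A]
    (hM : WeaklyMixing S) (hS : ShiftInvariant S) (c : S) (r : ℕ) :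
    PathConnectedSpace (WangComplex S r) := by
  refine ⟨⟨baseVertex c r⟩, fun p q => ?_⟩
  obtain ⟨c₁, x₁, rfl⟩ := exists_globalSec_eq hS p
  obtain ⟨c₂, x₂, rfl⟩ := exists_globalSec_eq hS q
  exact hM.joined_globalSec hS c₁ c₂ x₁ x₂

/-! #### Injectivity on vertices -/

/-- The site obtained by rounding down the coordinates of a point of the cube at `z`, relative
to `z`. -/
def floorOffset (hr : 1 ≤ r) {z : Lat D} (x : unitCube z) : Box D r :=
  ⟨fun i => ⌊x.1 i⌋ - z i, fun i => by
    have hlow : z i ≤ ⌊x.1 i⌋ := Int.le_floor.2 (x.2 i).1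
    have hupp : ⌊x.1 i⌋ ≤ z i + 1 := by exact_mod_cast (Int.floor_le (x.1 i)).trans (x.2 i).2
    exact abs_le.2 ⟨by lia, by lia⟩⟩

/-- The symbol of a point of `𝐗_r` at the site obtained by rounding down its coordinates. -/
def floorSymbol (S : Set (Config A D)) (hr : 1 ≤ r) : WangComplex S r → A :=
  Quot.lift (fun p => p.1.2.1 (floorOffset hr p.2)) (by
    rintro p q ⟨d, hsite, hmatch, hpt⟩
    refine hmatch _ _ (funext fun i => ?_)
    simp only [floorOffset, hsite, hpt, Pi.add_apply]
    ring)

theorem floorSymbol_globalSec (hS : ShiftInvariant S) (hr : 1 ≤ r) (c : S) (z : Lat D) :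
    floorSymbol S hr (globalSec hS c r fun i => (z i : ℝ)) = c.1 z := by
  rw [globalSec_apply hS c r (cast_mem_unitCube z)]
  change c.1 (z + (floorOffset hr ⟨_, cast_mem_unitCube z⟩).1) = c.1 z
  exact congrArg c.1 (funext fun i => by simp [floorOffset])

theorem VertexInjective.subsingleton (hS : ShiftInvariant S) (hr : 1 ≤ r)
    (h : VertexInjective S r) : S.Subsingleton := fun c hc c' hc' => funext fun z => by
  have hvertex := h _ _ z (proj_globalSec hS ⟨c, hc⟩ r _) (proj_globalSec hS ⟨c', hc'⟩ r _)
  exact (floorSymbol_globalSec hS hr ⟨c, hc⟩ z).symm.trans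
    ((congrArg (floorSymbol S hr) hvertex).trans (floorSymbol_globalSec hS hr ⟨c', hc'⟩ z))

theorem weaklyMixing_of_subsingleton [TopologicalSpace A] (h : S.Subsingleton) :
    WeaklyMixing S := by
  rintro U V - - ⟨⟨c, c'⟩, hU, hc, hc'⟩ ⟨⟨d, d'⟩, hV, hd, hd'⟩
  obtain rfl := h hc hd
  obtain rfl := h hc' hd'
  have hshift : ∀ b : Config A D, shift 0 b = b := fun b => funext fun z => congrArg b (add_zero z)
  exact ⟨0, (c, c'), ⟨hU, hc, hc'⟩, by rwa [hshift, hshift]⟩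

/-- The tile complexes of a one-point subshift are copies of `ℝ^D`. -/
def projHomeomorph (hS : ShiftInvariant S) (h : S.Subsingleton) (c : S) (r : ℕ) :
    WangComplex S r ≃ₜ (Fin D → ℝ) where
  toFun := TileComplex.proj _
  invFun := globalSec hS c r
  left_inv p := by
    obtain ⟨c', x, rfl⟩ := exists_globalSec_eq hS p
    obtain rfl : c = c' := Subtype.ext (h c.2 c'.2)
    rw [proj_globalSec]
  right_inv := proj_globalSec hS c r

theorem fundamentalTowerTrivial_of_subsingleton (hS : ShiftInvariant S) (h : S.Subsingleton)
    (R : ℕ) (c : S) : FundamentalTowerTrivial S R c := fun r => by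
  have := (projHomeomorph hS h c r).contractibleSpace
  have : Subsingleton (π_ 1 (WangComplex S r) (baseVertex c r)) :=
    HomotopyGroup.pi1EquivFundamentalGroup.subsingleton
  exact ⟨r, le_rfl, fun g => by rw [Subsingleton.elim g 1, map_one]⟩

/-! #### Basepoint-freeness -/

theorem zeta_comp {r s t : ℕ} (h : r ≤ s) (h' : s ≤ t) :
    (zeta S h).comp (zeta S h') = zeta S (h.trans h') := by
  ext p
  obtain ⟨p, rfl⟩ := Quot.exists_rep p
  rfl

theorem subsingleton_of_eventually_vertexInjective (hS : ShiftInvariant S)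
    (h : ∃ r₀, ∀ r ≥ r₀, VertexInjective S r) : S.Subsingleton :=
  let ⟨r₀, hr₀⟩ := h
  (hr₀ _ (le_max_left r₀ 1)).subsingleton hS (le_max_right r₀ 1)

namespace BasepointFree

variable [TopologicalSpace A] {k : ℕ}

theorem weaklyMixing (hB : BasepointFree S R k) (hS : ShiftInvariant S) : WeaklyMixing S := by
  rcases hB with h | ⟨hM, -⟩ | ⟨hM, -⟩
  · exact weaklyMixing_of_subsingleton (subsingleton_of_eventually_vertexInjective hS h)
  · exact hM
  · exact hM

theorem pathConnectedSpace [DiscreteTopology A] (hB : BasepointFree S R k)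
    (hS : ShiftInvariant S) (c : S) (r : ℕ) : PathConnectedSpace (WangComplex S r) :=
  (hB.weaklyMixing hS).pathConnectedSpace hS c r

theorem fundamentalTower (hB : BasepointFree S R k) (hS : ShiftInvariant S) (c : S) :
    (k = 1 ∧ ∃ c : S, FundamentalTowerAbelian S R c) ∨ ∃ c : S, FundamentalTowerTrivial S R c := by
  rcases hB with h | ⟨-, h⟩ | ⟨-, h⟩
  · exact .inr ⟨c, fundamentalTowerTrivial_of_subsingleton hS
      (subsingleton_of_eventually_vertexInjective hS h) R c⟩
  · exact .inl h
  · exact .inr h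

theorem towerActsTrivially [DiscreteTopology A] [NeZero k] (hB : BasepointFree S R k)
    (hS : ShiftInvariant S) (c : S) :
    TowerActsTrivially k fun (r s : Set.Ici R) (h : r ≤ s) => zeta S h := by
  intro r
  have hconn := hB.pathConnectedSpace hS c
  obtain ⟨rfl, c₀, h⟩ | ⟨c₀, h⟩ := hB.fundamentalTower hS c
  · obtain ⟨s, hs, habel⟩ := h r
    have := hconn s
    exact ⟨s, hs, actsTrivially_of_abelian (baseVertex c₀ s) habel⟩
  · obtain ⟨s, hs, htriv⟩ := h r
    have := hconn s
    exact ⟨s, hs, actsTrivially_of_trivial (baseVertex c₀ s) htriv⟩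

end BasepointFree

end Wang

/-! ### Naturality of sections and of the maps induced by a cellular automaton -/

section Naturality

theorem inclusion_comp_inclusion {X : Type*} [TopologicalSpace X] {U V W : Set X} (h : U ⊆ V)
    (h' : V ⊆ W) : (ContinuousMap.inclusion h').comp (ContinuousMap.inclusion h) =
      ContinuousMap.inclusion (h.trans h') := rfl

variable {A : Type} {D : ℕ} {S : Set (Config A D)} {r s : ℕ}

theorem exists_sec_eq_mk (a : Config A D) (r : ℕ) (x : Unflawed S a r) :
    ∃ (z : Lat D) (hz : z ∈ unflawed S a r) (hx : x.1 ∈ unitCube z),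
      corners z ⊆ unflawed S a r ∧
        sec S a r x = TileComplex.mk _ z ⟨block a z r, hz⟩ ⟨x.1, hx⟩ := by
  obtain ⟨z, hc, hx⟩ := exists_cube x
  exact ⟨z, hc fun _ => Or.inl rfl, hx, hc, sectionFun_eq S a r x z hc _ hx⟩

theorem zeta_comp_sec (a : Config A D) (h : r ≤ s) :
    (zeta S h).comp (sec S a s) = (sec S a r).comp (unflawedIncl S a h) := by
  ext x
  obtain ⟨z, hz, hx, hc, hsec⟩ := exists_sec_eq_mk a s x
  refine (congrArg (zeta S h) hsec).trans (Eq.symm ?_)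
  exact sectionFun_eq S a r _ z (hc.trans (unflawed_anti S a h)) _ hx

theorem unflawedIncl_comp_unflawedIncl {t : ℕ} (a : Config A D) (h : r ≤ s) (h' : s ≤ t) :
    (unflawedIncl S a h).comp (unflawedIncl S a h') = unflawedIncl S a (h.trans h') :=
  inclusion_comp_inclusion _ _

variable [TopologicalSpace A] {Φ : Config A D → Config A D} (hΦ : IsCellularAutomaton Φ)
  (hS : Set.MapsTo Φ S S) {q q' : ℕ} (hq : HasRadius Φ q)
include hΦ

theorem wangMap_mk (r : ℕ) {a : Config A D} {y z : Lat D} (hy : y ∈ unflawed S a (r + q))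
    (x : unitCube z) :
    wangMap hΦ hS hq r (TileComplex.mk _ z ⟨block a y (r + q), hy⟩ x) =
      TileComplex.mk _ z ⟨block (Φ a) y r, unflawed_subset hΦ hS hq a r hy⟩ x :=
  congrArg (fun w => TileComplex.mk (wangMatch S r) z w x)
    (Subtype.ext (hΦ.block_eq hq r hy.choose_spec.2))

theorem sec_comp_defectIncl (a : Config A D) (r : ℕ) :
    (sec S (Φ a) r).comp (defectIncl hΦ hS hq a r) =
      (wangMap hΦ hS hq r).comp (sec S a (r + q)) := by
  ext x
  obtain ⟨z, hz, hx, hc, hsec⟩ := exists_sec_eq_mk a (r + q) x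
  calc
    _ = TileComplex.mk _ z ⟨block (Φ a) z r, _⟩ ⟨x.1, hx⟩ :=
      sectionFun_eq S (Φ a) r _ z (hc.trans (unflawed_subset hΦ hS hq a r)) _ hx
    _ = _ := (wangMap_mk hΦ hS hq r hz ⟨x.1, hx⟩).symm
    _ = _ := congrArg (wangMap hΦ hS hq r) hsec.symm

theorem zeta_comp_wangMap (h : r ≤ s) :
    (zeta S h).comp (wangMap hΦ hS hq s) =
      (wangMap hΦ hS hq r).comp (zeta S (Nat.add_le_add_right h q)) := by
  ext p
  obtain ⟨⟨⟨z, _, c, hc, rfl⟩, x⟩, rfl⟩ := Quot.exists_rep p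
  exact (congrArg (zeta S h) (wangMap_mk hΦ hS hq s ⟨c, hc, rfl⟩ x)).trans
    (wangMap_mk hΦ hS hq r ⟨c, hc, rfl⟩ x).symm

theorem wangMap_comp_zeta_add (hq' : HasRadius Φ q') (h : q ≤ q') (r : ℕ) :
    (wangMap hΦ hS hq r).comp (zeta S (Nat.add_le_add_left h r)) = wangMap hΦ hS hq' r := by
  ext p
  obtain ⟨⟨⟨z, _, c, hc, rfl⟩, x⟩, rfl⟩ := Quot.exists_rep p
  exact (wangMap_mk hΦ hS hq r ⟨c, hc, rfl⟩ x).trans (wangMap_mk hΦ hS hq' r ⟨c, hc, rfl⟩ x).symm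

theorem unflawedIncl_comp_defectIncl (a : Config A D) (h : r ≤ s) :
    (unflawedIncl S (Φ a) h).comp (defectIncl hΦ hS hq a s) =
      (defectIncl hΦ hS hq a r).comp (unflawedIncl S a (Nat.add_le_add_right h q)) :=
  (inclusion_comp_inclusion _ _).trans (inclusion_comp_inclusion _ _).symm

theorem defectIncl_comp_unflawedIncl_add (hq' : HasRadius Φ q') (h : q ≤ q') (a : Config A D)
    (r : ℕ) : (defectIncl hΦ hS hq a r).comp (unflawedIncl S a (Nat.add_le_add_left h r)) =
      defectIncl hΦ hS hq' a r :=
  inclusion_comp_inclusion _ _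

end Naturality

/-! ### The radius of a cellular automaton -/

section Radius

variable {A B : Type} [TopologicalSpace A] [TopologicalSpace B] [DiscreteTopology B] {D : ℕ}

theorem exists_forall_mem_box (F : Finset (Lat D)) : ∃ n : ℕ, ∀ z ∈ F, ∀ i, |z i| ≤ (n : ℤ) := by
  refine ⟨F.sup fun z => Finset.univ.sup fun i => (z i).natAbs, fun z hz i => ?_⟩
  have hi : (z i).natAbs ≤ Finset.univ.sup fun i => (z i).natAbs :=
    Finset.le_sup (f := fun i => (z i).natAbs) (Finset.mem_univ i)
  rw [Int.abs_eq_natAbs]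
  exact_mod_cast hi.trans
    (Finset.le_sup (f := fun z : Lat D => Finset.univ.sup fun i => (z i).natAbs) hz)

theorem exists_forall_eq_of_block_eq {f : Config A D → B} (hf : Continuous f) (a : Config A D) :
    ∃ n : ℕ, ∀ b, block b 0 n = block a 0 n → f b = f a := by
  obtain ⟨F, u, hu, hsub⟩ := isOpen_pi_iff.1 ((isOpen_discrete {f a}).preimage hf) a rfl
  obtain ⟨n, hn⟩ := exists_forall_mem_box F
  refine ⟨n, fun b hb => hsub fun z hz => ?_⟩
  have hbz : b z = a z := by simpa only [block, zero_add] using congrFun hb ⟨z, hn z hz⟩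
  exact hbz ▸ (hu z hz).2

theorem exists_forall_eq_of_block_eq_block [Finite A] [DiscreteTopology A] {f : Config A D → B}
    (hf : Continuous f) : ∃ n : ℕ, ∀ a b, block a 0 n = block b 0 n → f a = f b := by
  choose n hn using exists_forall_eq_of_block_eq hf
  obtain ⟨T, hT⟩ := isCompact_univ.elim_finite_subcover
    (fun a : Config A D => {b | block b 0 (n a) = block a 0 (n a)})
    (fun a => isOpen_setOf_block_eq 0 _) fun a _ => Set.mem_iUnion.2 ⟨a, rfl⟩
  refine ⟨T.sup n, fun a b hab => ?_⟩
  obtain ⟨c, hc, hac⟩ := Set.mem_iUnion₂.1 (hT (Set.mem_univ a))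
  have hab' : block a 0 (n c) = block b 0 (n c) := congrArg (restrictBlock (Finset.le_sup hc)) hab
  exact (hn c a hac).trans (hn c b (hab'.symm.trans hac)).symm

theorem IsCellularAutomaton.exists_hasRadius [Finite A] [DiscreteTopology A]
    {Φ : Config A D → Config A D} (hΦ : IsCellularAutomaton Φ) : ∃ q, HasRadius Φ q := by
  obtain ⟨q, hq⟩ := exists_forall_eq_of_block_eq_block ((continuous_apply 0).comp hΦ.continuous)
  refine ⟨q, fun a b z hab => ?_⟩
  have hshift : Φ (shift z a) 0 = Φ (shift z b) 0 :=
    hq _ _ (by rwa [block_shift, block_shift, zero_add])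
  simpa only [hΦ.comm, shift, zero_add] using hshift

end Radius

/-! ### The homotopy signature and the induced maps on homotopy groups -/

section Signature

variable {A : Type} {D : ℕ} {S : Set (Config A D)} {R : ℕ} {a : Config A D} {k : ℕ} [NeZero k]
  {ω : ℝ≥0 → Fin D → ℝ}

theorem IsBaseRay.exists_staysFrom (hω : IsBaseRay S a ω) (r : ℕ) (t₀ : ℝ≥0) :
    ∃ t, t₀ ≤ t ∧ StaysFrom S a ω r t := by
  obtain ⟨t, ht⟩ := Filter.eventually_atTop.1 (hω.eventually r)
  exact ⟨t ⊔ t₀, le_sup_right, fun t' ht' => ht t' (le_sup_left.trans ht')⟩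

theorem StaysFrom.of_le {r s : ℕ} {t t' : ℝ≥0} (h : StaysFrom S a ω s t) (hr : r ≤ s)
    (ht : t ≤ t') : StaysFrom S a ω r t' :=
  fun t'' ht'' => realization_mono (unflawed_anti S a hr) (h t'' (ht.trans ht''))

/-- The segment of a ray between two times, as a path in `𝐆_r(a)`. -/
def rayPath (hω : Continuous ω) {r : ℕ} {t t' : ℝ≥0} (h : StaysFrom S a ω r t) (ht : t ≤ t') :
    Path (rayPt h) (rayPt (h.of_le le_rfl ht)) where
  toFun := raySegment h t'
  continuous_toFun := by
    unfold raySegment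
    fun_prop
  source' := Subtype.ext (by simp [raySegment, rayPt])
  target' := Subtype.ext (by simp [raySegment, rayPt, add_tsub_cancel_of_le ht])

instance : Preorder (RayIndex S R a ω) := Preorder.lift fun i => (i.r, i.t)

theorem IsBaseRay.isDirectedOrder (hω : IsBaseRay S a ω) : IsDirectedOrder (RayIndex S R a ω) where
  directed i j := by
    obtain ⟨t, ht, hstays⟩ := hω.exists_staysFrom (i.r ⊔ j.r : Set.Ici R) (i.t ⊔ j.t)
    exact ⟨⟨_, t, hstays⟩, ⟨le_sup_left, le_sup_left.trans ht⟩,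
      ⟨le_sup_right, le_sup_right.trans ht⟩⟩

theorem IsBaseRay.exists_le_rayIndex (hω : IsBaseRay S a ω) (r : Set.Ici R) :
    ∃ j : RayIndex S R a ω, r ≤ j.r := by
  obtain ⟨t, -, ht⟩ := hω.exists_staysFrom r 0
  exact ⟨⟨r, t, ht⟩, le_rfl⟩

theorem RayIndex.monotone_r : Monotone (RayIndex.r : RayIndex S R a ω → Set.Ici R) :=
  fun _ _ h => h.1

theorem DefectHomotopy.piTransport_rayPath {hω : Continuous ω} (α : DefectHomotopy S R a k hω)
    {i j : RayIndex S R a ω} (h : i.r ≤ j.r) (ht : i.t ≤ j.t) :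
    piTransport k (rayPath hω i.stays ht) (α.1 i) =
      piMap k (unflawedIncl S a h) (x := rayPt j.stays) rfl (α.1 j) :=
  (transports_iff (γ := rayPath hω i.stays ht)).1 (α.2 i j h ht)

/-- The homomorphism from `π_k[𝔾_∞(a), ω]` to the `k`-th homotopy group of `𝐗_r` given by the
section `ς^r_a`. -/
def secHom (hω : Continuous ω) (j : RayIndex S R a ω) :
    DefectHomotopy S R a k hω →* π_ k (WangComplex S j.r) (sec S a j.r (rayPt j.stays)) :=
  (piMap k (sec S a j.r) rfl).comp
    ((Pi.evalMonoidHom _ j).comp (DefectHomotopy S R a k hω).subtype)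

theorem freelyHomotopic_secHom (hω : Continuous ω) ⦃i j : RayIndex S R a ω⦄ (h : i ≤ j)
    (α : DefectHomotopy S R a k hω) :
    FreelyHomotopic (secHom hω i α) (piMap k (zeta S h.1) rfl (secHom hω j α)) := by
  have hα : FreelyHomotopic (α.1 i) (piMap k (unflawedIncl S a h.1) (x := rayPt j.stays)
      (y := rayPt (i.stays.of_le le_rfl h.2)) rfl (α.1 j)) :=
    ⟨rayPath hω i.stays h.2, DefectHomotopy.piTransport_rayPath α h.1 h.2⟩
  have hpt : sec S a i.r (rayPt (i.stays.of_le le_rfl h.2)) =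
      zeta S h.1 (sec S a j.r (rayPt j.stays)) :=
    (DFunLike.congr_fun (zeta_comp_sec a h.1) (rayPt j.stays)).symm
  have hsec : piMap k (zeta S h.1) rfl (secHom hω j α) = piMap k (sec S a i.r) hpt
      (piMap k (unflawedIncl S a h.1) rfl (α.1 j)) :=
    piMap_piMap_eq (zeta_comp_sec a h.1) rfl rfl rfl hpt (α.1 j)
  rw [hsec]
  exact hα.map (sec S a i.r) rfl hpt

variable [hconn : ∀ r : Set.Ici R, PathConnectedSpace (WangComplex S r)]
  (hT : TowerActsTrivially k fun (r s : Set.Ici R) (h : r ≤ s) => zeta S h)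
include hconn hT

theorem isHomotopySignature_iff (hω : IsBaseRay S a ω) {c : S}
    {f : DefectHomotopy S R a k hω.continuous →* ShiftHomotopy S R k c} :
    IsHomotopySignature c f ↔
      ∀ j α, FreelyHomotopic (secHom hω.continuous j α) ((f α).1 j.r) := by
  have := hω.isDirectedOrder (R := R)
  rw [← forall_transports_iff_freelyHomotopic (X := fun r : Set.Ici R => WangComplex S r)
    (hx := fun _ _ h => zeta_baseVertex h c) RayIndex.monotone_r hω.exists_le_rayIndex hT
    (fun _ _ _ => zeta_comp) (freelyHomotopic_secHom hω.continuous) f]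
  simp only [IsHomotopySignature, ← piMap_piMap (zeta S _) (sec S a _) rfl rfl]
  rfl

theorem existsUnique_isHomotopySignature (hω : IsBaseRay S a ω) (c : S) :
    ∃! f : DefectHomotopy S R a k hω.continuous →* ShiftHomotopy S R k c,
      IsHomotopySignature c f := by
  have := hω.isDirectedOrder (R := R)
  simp only [isHomotopySignature_iff hT hω]
  exact existsUnique_hom_homotopyLim (X := fun r : Set.Ici R => WangComplex S r)
    (hx := fun _ _ h => zeta_baseVertex h c) RayIndex.monotone_r hω.exists_le_rayIndex hT
    (fun _ _ _ => zeta_comp) (freelyHomotopic_secHom hω.continuous)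

end Signature

section CAMap

variable {A : Type} [TopologicalSpace A] {D : ℕ} {S : Set (Config A D)} {R k : ℕ} [NeZero k]
  {Φ : Config A D → Config A D} (hΦ : IsCellularAutomaton Φ) (hS : Set.MapsTo Φ S S)
  {q q' : ℕ} (hq : HasRadius Φ q) (hq' : HasRadius Φ q') {c c' : S}

/-- The homomorphism from `π_k(S, c)` to the `k`-th homotopy group of `𝐗_r` based at `Φ(c)` given
by the map `Φ_* : 𝐗_{r+q} → 𝐗_r`. -/
def wangHom (c : S) (r : Set.Ici R) :
    ShiftHomotopy S R k c →* π_ k (WangComplex S r) (baseVertex ⟨Φ c, hS c.2⟩ r) :=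
  (piMap k (wangMap hΦ hS hq r) (wangMap_baseVertex hΦ hS hq r c)).comp
    ((Pi.evalMonoidHom _ (addIdx r q)).comp (ShiftHomotopy S R k c).subtype)

theorem piMap_zeta_wangHom {r s : Set.Ici R} (h : r ≤ s) (β : ShiftHomotopy S R k c) :
    piMap k (zeta S h) (zeta_baseVertex h _) (wangHom hΦ hS hq c s β) =
      wangHom hΦ hS hq c r β := by
  have hβ := β.2 (addIdx r q) (addIdx s q) (Nat.add_le_add_right h q)
  calc
    _ = piMap k (wangMap hΦ hS hq r) (wangMap_baseVertex hΦ hS hq r c)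
        (piMap k (zeta S (Nat.add_le_add_right h q)) (zeta_baseVertex _ c) (β.1 (addIdx s q))) :=
      piMap_piMap_eq (zeta_comp_wangMap hΦ hS hq h) _ _ _ _ _
    _ = wangHom hΦ hS hq c r β := congrArg _ hβ

theorem wangHom_eq_of_le (h : q ≤ q') (r : Set.Ici R) (β : ShiftHomotopy S R k c) :
    wangHom hΦ hS hq c r β = wangHom hΦ hS hq' c r β := by
  have hβ := β.2 (addIdx r q) (addIdx r q') (Nat.add_le_add_left h r.1)
  calc
    _ = piMap k (wangMap hΦ hS hq r) _ (piMap k (zeta S (Nat.add_le_add_left h r.1)) _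
        (β.1 (addIdx r q'))) := (congrArg _ hβ).symm
    _ = wangHom hΦ hS hq' c r β :=
      piMap_piMap_of_comp_eq (wangMap_comp_zeta_add hΦ hS hq hq' h r) _ _ _ _

theorem wangHom_eq (r : Set.Ici R) (β : ShiftHomotopy S R k c) :
    wangHom hΦ hS hq c r β = wangHom hΦ hS hq' c r β := by
  rcases le_total q q' with h | h
  · exact wangHom_eq_of_le hΦ hS hq hq' h r β
  · exact (wangHom_eq_of_le hΦ hS hq' hq h r β).symm

theorem freelyHomotopic_wangHom ⦃r s : Set.Ici R⦄ (h : r ≤ s) (β : ShiftHomotopy S R k c) :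
    FreelyHomotopic (wangHom hΦ hS hq c r β)
      (piMap k (zeta S h) rfl (wangHom hΦ hS hq c s β)) := by
  rw [← piMap_zeta_wangHom hΦ hS hq h β]
  exact (FreelyHomotopic.refl _).map _ _ _

variable [hconn : ∀ r : Set.Ici R, PathConnectedSpace (WangComplex S r)]
  (hT : TowerActsTrivially k fun (r s : Set.Ici R) (h : r ≤ s) => zeta S h)
include hconn hT

theorem isHomotopyCAMap_iff {f : ShiftHomotopy S R k c →* ShiftHomotopy S R k c'} :
    IsHomotopyCAMap hΦ hS c c' f ↔ ∀ (q : ℕ) (hq : HasRadius Φ q) (r : Set.Ici R) β,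
      FreelyHomotopic (wangHom hΦ hS hq c r β) ((f β).1 r) := by
  have hcomp (q : ℕ) (hq : HasRadius Φ q) {r s : Set.Ici R} (h : r ≤ s) β :
      piMap k (zeta S h) rfl (wangHom hΦ hS hq c s β) = piMap k ((zeta S h).comp
        (wangMap hΦ hS hq s)) (congrArg (zeta S h) (wangMap_baseVertex hΦ hS hq s c))
        (β.1 (addIdx s q)) :=
    piMap_piMap (zeta S h) (wangMap hΦ hS hq s) (wangMap_baseVertex hΦ hS hq s c) rfl _
  refine forall₂_congr fun q hq => Iff.trans ?_ <|
    forall_transports_iff_freelyHomotopic (X := fun r : Set.Ici R => WangComplex S r) (ρ := id)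
      (hx := fun _ _ h => zeta_baseVertex h c') monotone_id (fun r => ⟨r, le_rfl⟩) hT
      (fun _ _ _ => zeta_comp) (freelyHomotopic_wangHom hΦ hS hq) f
  simp only [id_eq, hcomp]

theorem existsUnique_isHomotopyCAMap (hΦr : ∃ q, HasRadius Φ q) (c c' : S) :
    ∃! f : ShiftHomotopy S R k c →* ShiftHomotopy S R k c', IsHomotopyCAMap hΦ hS c c' f := by
  obtain ⟨q, hq⟩ := hΦr
  have hiff (f : ShiftHomotopy S R k c →* ShiftHomotopy S R k c') :
      (∀ r β, FreelyHomotopic (wangHom hΦ hS hq c r β) ((f β).1 r)) ↔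
        IsHomotopyCAMap hΦ hS c c' f := by
    rw [isHomotopyCAMap_iff hΦ hS hT]
    exact ⟨fun hf q' hq' r β => wangHom_eq hΦ hS hq' hq r β ▸ hf r β, fun hf => hf q hq⟩
  refine (existsUnique_congr hiff).1 ?_
  exact existsUnique_hom_homotopyLim (X := fun r : Set.Ici R => WangComplex S r)
    (hx := fun _ _ h => zeta_baseVertex h c') monotone_id (fun r => ⟨r, le_rfl⟩) hT
    (fun _ _ _ => zeta_comp) (freelyHomotopic_wangHom hΦ hS hq)

end CAMap

section InverseLimit

variable {ι : Type} [Preorder ι] [IsDirectedOrder ι] {G : ι → Type} [∀ i, Group (G i)]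
  {f : ∀ ⦃i j : ι⦄, i ≤ j → G j →* G i} {K : Subgroup (∀ i, G i)} {P : Set ι} {L : Type} [Group L]

theorem existsUnique_hom_of_isCofinal
    (hf : ∀ ⦃i j l⦄ (h : i ≤ j) (h' : j ≤ l) x, f h (f h' x) = f (h.trans h') x)
    (hK : ∀ x, x ∈ K ↔ ∀ ⦃i j⦄ (h : i ≤ j), f h (x j) = x i) (hP : IsCofinal P)
    {φ : ∀ i : P, L →* G i} (hφ : ∀ ⦃i j : P⦄ (h : i ≤ j) α, f h (φ j α) = φ i α) :
    ∃! F : L →* K, ∀ (i : P) α, (F α).1 i = φ i α := by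
  have hex (i : ι) : ∃ j : P, i ≤ (j : ι) :=
    (hP i).elim fun j hj => ⟨⟨j, hj.1⟩, hj.2⟩
  choose d hd using hex
  let F : L →* ∀ i, G i := MonoidHom.pi fun i => (f (hd i)).comp (φ (d i))
  have hF : ∀ (i : ι) (j : P) (h : i ≤ j) α, F α i = f h (φ j α) := fun i j h α => by
    obtain ⟨l, hl, hjl⟩ := exists_ge_ge (d i).1 j.1
    have hdl : d i ≤ d l := hl.trans (hd l)
    have hj : j ≤ d l := hjl.trans (hd l)
    change f (hd i) (φ (d i) α) = f h (φ j α)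
    rw [← hφ hdl, ← hφ hj, hf (hd i), hf h]
  refine ⟨F.codRestrict K fun α => (hK _).2 fun i j h => ?_, fun i α => ?_, fun F' hF' => ?_⟩
  · rw [hF i (d j) (h.trans (hd j)), hF j (d j) (hd j), hf]
  · exact (hF i (d i) (hd i) α).trans (hφ (hd i) α)
  · refine MonoidHom.ext fun α => Subtype.ext (funext fun i => ?_)
    rw [← (hK _).1 (F' α).2 (hd i), hF']
    rfl

end InverseLimit

section HomotopyInclusion

variable {A : Type} {D : ℕ} {S : Set (Config A D)} {R : ℕ} {a : Config A D} {k : ℕ} [NeZero k]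
  {ω : ℝ≥0 → Fin D → ℝ}

/-- The linear path between two nonnegative numbers. -/
def nnrealPath {t t' : ℝ≥0} (ht : t ≤ t') : Path (t : ℝ) t' where
  toFun u := (t + unitInterval.toNNReal u * (t' - t) : ℝ≥0)
  continuous_toFun := by fun_prop
  source' := by simp
  target' := by
    rw [NNReal.coe_inj]
    simp [add_tsub_cancel_of_le ht]

/-- The tail of a ray, extended to `ℝ` by a constant. -/
def rayTail (hω : Continuous ω) {r : ℕ} {t : ℝ≥0} (h : StaysFrom S a ω r t) :
    C(ℝ, Unflawed S a r) :=
  ⟨fun v => ⟨ω (t ⊔ v.toNNReal), h _ le_sup_left⟩, by fun_prop⟩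

theorem rayTail_coe (hω : Continuous ω) {r : ℕ} {t t' : ℝ≥0} (h : StaysFrom S a ω r t)
    (ht : t ≤ t') : rayTail hω h t' = rayPt (h.of_le le_rfl ht) :=
  Subtype.ext (congrArg ω (by rw [Real.toNNReal_coe, sup_eq_right.2 ht]))

theorem homotopic_rayPath_trans (hω : Continuous ω) {r : ℕ} {t t' t'' : ℝ≥0}
    (h : StaysFrom S a ω r t) (ht : t ≤ t') (ht' : t' ≤ t'') :
    ((rayPath hω h ht).trans (rayPath hω (h.of_le le_rfl ht) ht')).Homotopic
      (rayPath hω h (ht.trans ht')) := by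
  have hx : rayPt h = rayTail hω h t := (rayTail_coe hω h le_rfl).symm
  have hy : rayPt (h.of_le le_rfl (ht.trans ht')) = rayTail hω h t'' :=
    (rayTail_coe hω h (ht.trans ht')).symm
  have hpath : rayPath hω h (ht.trans ht') =
      ((nnrealPath (ht.trans ht')).map (rayTail hω h).continuous).cast hx hy :=
    Path.ext (funext fun u => (rayTail_coe hω h le_self_add).symm)
  have htrans : (rayPath hω h ht).trans (rayPath hω (h.of_le le_rfl ht) ht') =
      (((nnrealPath ht).trans (nnrealPath ht')).map (rayTail hω h).continuous).cast hx hy := by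
    refine Path.ext (funext fun u => ?_)
    rw [Path.cast_coe, Path.map_coe, Function.comp_apply, Path.trans_apply, Path.trans_apply]
    split_ifs
    · exact (rayTail_coe hω h le_self_add).symm
    · exact (rayTail_coe hω h (ht.trans le_self_add)).symm
  rw [hpath, htrans]
  exact ((SimplyConnectedSpace.paths_homotopic _ _).map (rayTail hω h)).pathCast hx hy

theorem rayPath_self (hω : Continuous ω) {r : ℕ} {t : ℝ≥0} (h : StaysFrom S a ω r t) :
    rayPath hω h le_rfl = Path.refl (rayPt h) :=
  Path.ext (funext fun _ => Subtype.ext (congrArg ω (by simp)))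

theorem DefectHomotopy.piMap_unflawedIncl {hω : Continuous ω} (α : DefectHomotopy S R a k hω)
    {r s : Set.Ici R} (h : r ≤ s) {t : ℝ≥0} (hr : StaysFrom S a ω r t) (hs : StaysFrom S a ω s t) :
    piMap k (unflawedIncl S a h) (x := rayPt hs) (y := rayPt hr) rfl (α.1 ⟨s, t, hs⟩) =
      α.1 ⟨r, t, hr⟩ := by
  have hα := DefectHomotopy.piTransport_rayPath α (i := ⟨r, t, hr⟩) (j := ⟨s, t, hs⟩) h le_rfl
  rw [rayPath_self, piTransport_refl] at hα
  exact hα.symm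

/-- The bonding homomorphisms of the inverse system of homotopy groups of the unflawed regions,
based along the ray `ω`: an inclusion followed by moving the basepoint back along `ω`. -/
def rayRestrict (k : ℕ) [NeZero k] (hω : Continuous ω) ⦃i j : RayIndex S R a ω⦄ (h : i ≤ j) :
    π_ k (Unflawed S a j.r) (rayPt j.stays) →* π_ k (Unflawed S a i.r) (rayPt i.stays) :=
  (piTransport k (rayPath hω i.stays h.2).symm).comp
    (piMap k (unflawedIncl S a h.1) (y := rayPt (i.stays.of_le le_rfl h.2)) rfl)

theorem rayRestrict_rayRestrict (hω : Continuous ω) ⦃i j l : RayIndex S R a ω⦄ (h : i ≤ j)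
    (h' : j ≤ l) (α : π_ k (Unflawed S a l.r) (rayPt l.stays)) :
    rayRestrict k hω h (rayRestrict k hω h' α) = rayRestrict k hω (h.trans h') α := by
  let p := rayPath hω i.stays h.2
  let p' := rayPath hω (i.stays.of_le le_rfl h.2) h'.2
  let β := piMap k (unflawedIncl S a (h.1.trans h'.1))
    (y := rayPt (i.stays.of_le le_rfl (h.2.trans h'.2))) rfl α
  have hβ : piMap k (unflawedIncl S a h.1) rfl (piMap k (unflawedIncl S a h'.1)
      (y := rayPt (j.stays.of_le le_rfl h'.2)) rfl α) = β :=
    piMap_piMap_of_comp_eq (unflawedIncl_comp_unflawedIncl a h.1 h'.1)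
      (x := rayPt l.stays) (y := rayPt (j.stays.of_le le_rfl h'.2))
      (z := rayPt (i.stays.of_le le_rfl (h.2.trans h'.2))) rfl rfl rfl α
  calc
    _ = piTransport k p.symm (piTransport k p'.symm (piMap k (unflawedIncl S a h.1) rfl
        (piMap k (unflawedIncl S a h'.1) rfl α))) :=
      congrArg (piTransport k p.symm)
        (piMap_piTransport_of_forall_eq (unflawedIncl S a h.1) rfl rfl (fun _ => rfl) _)
    _ = piTransport k p.symm (piTransport k p'.symm β) :=
      congrArg (fun β => piTransport k p.symm (piTransport k p'.symm β)) hβ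
    _ = piTransport k (p.trans p').symm β := by rw [Path.trans_symm, piTransport_trans]
    _ = rayRestrict k hω (h.trans h') α :=
      piTransport_congr (homotopic_rayPath_trans hω i.stays h.2 h'.2).symm₂ β

theorem mem_defectHomotopy_iff {hω : Continuous ω}
    (α : ∀ i : RayIndex S R a ω, π_ k (Unflawed S a i.r) (rayPt i.stays)) :
    α ∈ DefectHomotopy S R a k hω ↔
      ∀ ⦃i j : RayIndex S R a ω⦄ (h : i ≤ j), rayRestrict k hω h (α j) = α i := by
  refine ⟨fun hα i j h => ?_, fun hα i j h ht => ?_⟩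
  · rw [← piTransport_symm_piTransport (rayPath hω i.stays h.2) (α i),
      DefectHomotopy.piTransport_rayPath ⟨α, hα⟩ h.1 h.2]
    rfl
  · refine transports_iff (γ := rayPath hω i.stays ht) |>.2 ?_
    rw [← hα ⟨h, ht⟩]
    exact piTransport_piTransport_symm _ _

section CellularAutomaton

variable [TopologicalSpace A] {Φ : Config A D → Config A D} (hΦ : IsCellularAutomaton Φ)
  (hS : Set.MapsTo Φ S S) {q q' : ℕ} (hq : HasRadius Φ q) (hq' : HasRadius Φ q')

include hΦ hS hq in
theorem IsBaseRay.image (hω : IsBaseRay S a ω) : IsBaseRay S (Φ a) ω :=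
  ⟨hω.continuous, hω.tendsto, fun r => (hω.eventually (r + q)).mono fun _ ht =>
    realization_mono (unflawed_subset hΦ hS hq a r) ht⟩

/-- The homomorphism from `π_k[𝔾_∞(a), ω]` to the `k`-th homotopy group of `𝐆_r(Φ(a))` based at
`ω(t)` given by the inclusion `𝐆_{r+q}(a) ⊆ 𝐆_r(Φ(a))`. -/
def inclHom (hω : Continuous ω) {r : Set.Ici R} {t : ℝ≥0} (h : StaysFrom S a ω (addIdx r q) t) :
    DefectHomotopy S R a k hω →* π_ k (Unflawed S (Φ a) r) (rayPt (h.image hΦ hS hq)) :=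
  (piMap k (defectIncl hΦ hS hq a r) (x := rayPt h) rfl).comp
    ((Pi.evalMonoidHom _ (⟨addIdx r q, t, h⟩ : RayIndex S R a ω)).comp
      (DefectHomotopy S R a k hω).subtype)

theorem rayRestrict_inclHom (hω : Continuous ω) ⦃i j : RayIndex S R (Φ a) ω⦄ (h : i ≤ j)
    (hi : StaysFrom S a ω (addIdx i.r q) i.t) (hj : StaysFrom S a ω (addIdx j.r q) j.t)
    (α : DefectHomotopy S R a k hω) :
    rayRestrict k hω h (inclHom hΦ hS hq hω hj α) = inclHom hΦ hS hq hω hi α := by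
  let i' : RayIndex S R a ω := ⟨addIdx i.r q, i.t, hi⟩
  let j' : RayIndex S R a ω := ⟨addIdx j.r q, j.t, hj⟩
  have h' : i' ≤ j' := ⟨Nat.add_le_add_right h.1 q, h.2⟩
  have hincl : piMap k (unflawedIncl S (Φ a) h.1) (y := rayPt (i.stays.of_le le_rfl h.2)) rfl
      (inclHom hΦ hS hq hω hj α) =
      piMap k (defectIncl hΦ hS hq a i.r) rfl (piMap k (unflawedIncl S a h'.1)
        (y := rayPt (i'.stays.of_le le_rfl h.2)) rfl (α.1 j')) :=
    piMap_piMap_eq (unflawedIncl_comp_defectIncl hΦ hS hq a h.1) (y := rayPt j.stays)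
      (z := rayPt (i.stays.of_le le_rfl h.2)) rfl rfl rfl rfl (α.1 j')
  calc
    _ = piTransport k (rayPath hω i.stays h.2).symm (piMap k (defectIncl hΦ hS hq a i.r) rfl
        (piMap k (unflawedIncl S a h'.1) rfl (α.1 j'))) := congrArg _ hincl
    _ = piMap k (defectIncl hΦ hS hq a i.r) (y := rayPt i.stays) rfl
        (rayRestrict k hω h' (α.1 j')) :=
      (piMap_piTransport_of_forall_eq (defectIncl hΦ hS hq a i.r) rfl rfl
        (γ := (rayPath hω i'.stays h.2).symm) (fun _ => rfl) _).symm
    _ = inclHom hΦ hS hq hω hi α := congrArg _ ((mem_defectHomotopy_iff _).1 α.2 h')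

theorem inclHom_eq_of_le (h : q ≤ q') (hω : Continuous ω) {r : Set.Ici R} {t : ℝ≥0}
    (ht : StaysFrom S a ω (addIdx r q) t) (ht' : StaysFrom S a ω (addIdx r q') t)
    (α : DefectHomotopy S R a k hω) :
    inclHom hΦ hS hq hω ht α = inclHom hΦ hS hq' hω ht' α := by
  have hr : addIdx r q ≤ addIdx r q' := Nat.add_le_add_left h r.1
  calc
    inclHom hΦ hS hq hω ht α = piMap k (defectIncl hΦ hS hq a r) (x := rayPt ht)
        (y := rayPt (ht.image hΦ hS hq)) rfl
        (piMap k (unflawedIncl S a hr) (y := rayPt ht) rfl (α.1 ⟨addIdx r q', t, ht'⟩)) :=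
      (congrArg _ (DefectHomotopy.piMap_unflawedIncl α hr ht ht')).symm
    _ = inclHom hΦ hS hq' hω ht' α :=
      piMap_piMap_of_comp_eq (defectIncl_comp_unflawedIncl_add hΦ hS hq hq' h a r)
        (x := rayPt ht') (y := rayPt ht) (z := rayPt (ht.image hΦ hS hq)) rfl rfl rfl _

theorem inclHom_eq (hω : Continuous ω) {r : Set.Ici R} {t : ℝ≥0}
    (ht : StaysFrom S a ω (addIdx r q) t) (ht' : StaysFrom S a ω (addIdx r q') t)
    (α : DefectHomotopy S R a k hω) :
    inclHom hΦ hS hq hω ht α = inclHom hΦ hS hq' hω ht' α := by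
  rcases le_total q q' with h | h
  · exact inclHom_eq_of_le hΦ hS hq hq' h hω ht ht' α
  · exact (inclHom_eq_of_le hΦ hS hq' hq h hω ht' ht α).symm

theorem existsUnique_isHomotopyInclusion (hΦr : ∃ q, HasRadius Φ q) (hω : IsBaseRay S a ω) :
    ∃! f : DefectHomotopy S R a k hω.continuous →* DefectHomotopy S R (Φ a) k hω.continuous,
      IsHomotopyInclusion hΦ hS f := by
  obtain ⟨q, hq⟩ := hΦr
  have := (hω.image hΦ hS hq).isDirectedOrder (R := R)
  let P : Set (RayIndex S R (Φ a) ω) := {i | StaysFrom S a ω (addIdx i.r q) i.t}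
  have hP : IsCofinal P := fun i => by
    obtain ⟨t, hit, ht⟩ := hω.exists_staysFrom (addIdx i.r q) i.t
    exact ⟨⟨i.r, t, ht.image hΦ hS hq⟩, ht, le_rfl, hit⟩
  obtain ⟨f, hf, huniq⟩ := existsUnique_hom_of_isCofinal (P := P)
    (rayRestrict_rayRestrict (k := k) hω.continuous) mem_defectHomotopy_iff hP
    (φ := fun i => inclHom hΦ hS hq hω.continuous i.2)
    fun i j h => rayRestrict_inclHom hΦ hS hq hω.continuous h i.2 j.2
  refine ⟨f, fun q' hq' r t h α => ?_, fun f' hf' => huniq f' fun i => hf' q hq i.1.r i.1.t i.2⟩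
  let i : RayIndex S R (Φ a) ω := ⟨r, t, h.image hΦ hS hq'⟩
  obtain ⟨t', htt', h'⟩ := hω.exists_staysFrom (addIdx r q) t
  let j : RayIndex S R (Φ a) ω := ⟨r, t', h'.image hΦ hS hq⟩
  have hij : i ≤ j := ⟨le_rfl, htt'⟩
  calc
    (f α).1 i = rayRestrict k hω.continuous hij ((f α).1 j) :=
      ((mem_defectHomotopy_iff _).1 (f α).2 hij).symm
    _ = rayRestrict k hω.continuous hij (inclHom hΦ hS hq hω.continuous h' α) :=
      congrArg _ (hf ⟨j, h'⟩ α)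
    _ = rayRestrict k hω.continuous hij
        (inclHom hΦ hS hq' hω.continuous (h.of_le le_rfl htt') α) :=
      congrArg _ (inclHom_eq hΦ hS hq hq' hω.continuous h' _ α)
    _ = inclHom hΦ hS hq' hω.continuous h α := rayRestrict_inclHom hΦ hS hq' hω.continuous hij _ _ α

end CellularAutomaton

end HomotopyInclusion

section HomotopySquare

variable {A : Type} [TopologicalSpace A] {D : ℕ} {S : Set (Config A D)} {R : ℕ}
  {a : Config A D} {k : ℕ} [NeZero k] {ω : ℝ≥0 → Fin D → ℝ} {Φ : Config A D → Config A D}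
  {hΦ : IsCellularAutomaton Φ} {hS : Set.MapsTo Φ S S} {q : ℕ}

theorem IsHomotopyInclusion.secHom_eq (hq : HasRadius Φ q) {hω : Continuous ω}
    {πι : DefectHomotopy S R a k hω →* DefectHomotopy S R (Φ a) k hω}
    (hι : IsHomotopyInclusion hΦ hS πι) {r : Set.Ici R} {t : ℝ≥0}
    (h : StaysFrom S a ω (addIdx r q) t) (α : DefectHomotopy S R a k hω) :
    secHom hω ⟨r, t, h.image hΦ hS hq⟩ (πι α) = piMap k (wangMap hΦ hS hq r)
      (DFunLike.congr_fun (sec_comp_defectIncl hΦ hS hq a r) (rayPt h)).symm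
      (secHom hω ⟨addIdx r q, t, h⟩ α) :=
  calc
    _ = piMap k (sec S (Φ a) r) _ (piMap k (defectIncl hΦ hS hq a r) rfl
        (α.1 ⟨addIdx r q, t, h⟩)) := congrArg _ (hι q hq r t h α)
    _ = _ := piMap_piMap_eq (sec_comp_defectIncl hΦ hS hq a r) _ _ _ _ _

theorem homotopy_square [∀ r : Set.Ici R, PathConnectedSpace (WangComplex S r)]
    (hT : TowerActsTrivially k fun (r s : Set.Ici R) (h : r ≤ s) => zeta S h)
    (hΦr : ∃ q, HasRadius Φ q) (hω : IsBaseRay S a ω) {c c' : S}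
    {πa : DefectHomotopy S R a k hω.continuous →* ShiftHomotopy S R k c}
    {πb : DefectHomotopy S R (Φ a) k hω.continuous →* ShiftHomotopy S R k c'}
    {πι : DefectHomotopy S R a k hω.continuous →* DefectHomotopy S R (Φ a) k hω.continuous}
    {πΦ : ShiftHomotopy S R k c →* ShiftHomotopy S R k c'}
    (ha : IsHomotopySignature c πa) (hb : IsHomotopySignature c' πb)
    (hι : IsHomotopyInclusion hΦ hS πι) (hc : IsHomotopyCAMap hΦ hS c c' πΦ) :
    πb.comp πι = πΦ.comp πa := by
  obtain ⟨q, hq⟩ := hΦr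
  refine MonoidHom.ext fun α => homotopyLim_ext (X := fun r : Set.Ici R => WangComplex S r)
    (hx := fun _ _ h => zeta_baseVertex h c') hT fun r => ⟨r, le_rfl, ?_⟩
  obtain ⟨t, -, ht⟩ := hω.exists_staysFrom (addIdx r q) 0
  have hsecb : FreelyHomotopic (secHom hω.continuous ⟨r, t, ht.image hΦ hS hq⟩ (πι α))
      ((πb (πι α)).1 r) :=
    (isHomotopySignature_iff hT (hω.image hΦ hS hq)).1 hb ⟨r, t, ht.image hΦ hS hq⟩ (πι α)
  have hseca : FreelyHomotopic (secHom hω.continuous ⟨r, t, ht.image hΦ hS hq⟩ (πι α))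
      (wangHom hΦ hS hq c r (πa α)) := by
    rw [hι.secHom_eq hq ht α]
    exact ((isHomotopySignature_iff hT hω).1 ha ⟨addIdx r q, t, ht⟩ α).map _ _ _
  have hwang : FreelyHomotopic (wangHom hΦ hS hq c r (πa α)) ((πΦ (πa α)).1 r) :=
    (isHomotopyCAMap_iff hΦ hS hT).1 hc q hq r (πa α)
  exact hsecb.symm.trans (hseca.trans hwang)

end HomotopySquare

/-! ### Homology and cohomology -/

section Homology

universe u

variable (G : Type u) [AddCommGroup G] (k : ℕ)

theorem homologyMap_homologyMap {X Y Z : Type} [TopologicalSpace X] [TopologicalSpace Y]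
    [TopologicalSpace Z] (g : C(Y, Z)) (f : C(X, Y)) (x : Homology G k X) :
    homologyMap G k g (homologyMap G k f x) = homologyMap G k (g.comp f) x := by
  have h := (homologyFunctor G k).map_comp (TopCat.ofHom f) (TopCat.ofHom g)
  exact (congrArg (fun φ => φ.hom x) h).symm

theorem cohomologyMap_cohomologyMap {X Y Z : Type} [TopologicalSpace X] [TopologicalSpace Y]
    [TopologicalSpace Z] (g : C(Y, Z)) (f : C(X, Y)) (x : Cohomology G k Z) :
    cohomologyMap G k f (cohomologyMap G k g x) = cohomologyMap G k (g.comp f) x := by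
  have h := (cohomologyFunctor G k).map_comp (TopCat.ofHom g).op (TopCat.ofHom f).op
  exact (congrArg (fun φ => φ.hom x) h).symm

theorem homologyMap_square {X Y Y' Z : Type} [TopologicalSpace X] [TopologicalSpace Y]
    [TopologicalSpace Y'] [TopologicalSpace Z] {g : C(Y, Z)} {f : C(X, Y)} {g' : C(Y', Z)}
    {f' : C(X, Y')} (h : g.comp f = g'.comp f') (x : Homology G k X) :
    homologyMap G k g (homologyMap G k f x) = homologyMap G k g' (homologyMap G k f' x) := by
  rw [homologyMap_homologyMap, homologyMap_homologyMap, h]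

theorem cohomologyMap_square {X Y Y' Z : Type} [TopologicalSpace X] [TopologicalSpace Y]
    [TopologicalSpace Y'] [TopologicalSpace Z] {g : C(Y, Z)} {f : C(X, Y)} {g' : C(Y', Z)}
    {f' : C(X, Y')} (h : g.comp f = g'.comp f') (x : Cohomology G k Z) :
    cohomologyMap G k f (cohomologyMap G k g x) =
      cohomologyMap G k f' (cohomologyMap G k g' x) := by
  rw [cohomologyMap_cohomologyMap, cohomologyMap_cohomologyMap, h]

section Limits

variable {ι : Type} [Preorder ι] {H : ι → Type u} [∀ i, AddCommGroup (H i)] {L : Type u}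
  [AddCommGroup L]

theorem existsUnique_hom_invLim {f : ∀ i j, i ≤ j → H j →+ H i} (φ : ∀ i, L →+ H i)
    (hφ : ∀ i j (h : i ≤ j) x, f i j h (φ j x) = φ i x) :
    ∃! F : L →+ invLim H f, ∀ x i, (F x).1 i = φ i x :=
  ⟨(AddMonoidHom.pi φ).codRestrict (invLim H f) fun x i j h => hφ i j h x, fun _ _ => rfl,
    fun _ hF => AddMonoidHom.ext fun x => Subtype.ext (funext fun i => hF x i)⟩

theorem existsUnique_hom_directLimit [DecidableEq ι] {f : ∀ i j, i ≤ j → H i →+ H j}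
    (φ : ∀ i, H i →+ L) (hφ : ∀ i j (h : i ≤ j) x, φ j (f i j h x) = φ i x) :
    ∃! F : AddCommGroup.DirectLimit H f →+ L,
      ∀ i x, F (AddCommGroup.DirectLimit.of H f i x) = φ i x :=
  ⟨AddCommGroup.DirectLimit.lift H f L φ hφ, AddCommGroup.DirectLimit.lift_of L φ hφ,
    fun _ hF => AddCommGroup.DirectLimit.hom_ext L fun i => AddMonoidHom.ext fun x =>
      (hF i x).trans (AddCommGroup.DirectLimit.lift_of L φ hφ i x).symm⟩

/-- A component of the inverse limit. -/
def invLimProj {f : ∀ i j, i ≤ j → H j →+ H i} (i : ι) : invLim H f →+ H i :=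
  (Pi.evalAddMonoidHom H i).comp (invLim H f).subtype

end Limits

section ShiftedMaps

variable {R : ℕ} {X Y : Set.Ici R → Type} [∀ r, TopologicalSpace (X r)]
  [∀ r, TopologicalSpace (Y r)]

/-- The maps `g_{q,r} : X_{r+q} → Y_r`, where `q` satisfies `P`, commute with the bonding maps of
the inverse systems `X` and `Y`, and for different `q` represent the same morphism of inverse
systems. -/
structure IsShiftedMap (ρ : ∀ ⦃r s : Set.Ici R⦄, r ≤ s → C(X s, X r))
    (τ : ∀ ⦃r s : Set.Ici R⦄, r ≤ s → C(Y s, Y r)) {P : ℕ → Prop}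
    (g : ∀ q, P q → ∀ r : Set.Ici R, C(X (addIdx r q), Y r)) : Prop where
  comp_bond : ∀ {q} (hq : P q) ⦃r s : Set.Ici R⦄ (h : r ≤ s),
    (τ h).comp (g q hq s) = (g q hq r).comp (ρ (Nat.add_le_add_right h q))
  comp_bond_add : ∀ {q q'} (hq : P q) (hq' : P q') (h : q ≤ q') (r : Set.Ici R),
    (g q hq r).comp (ρ (Nat.add_le_add_left h r.1)) = g q' hq' r

namespace IsShiftedMap

variable {ρ : ∀ ⦃r s : Set.Ici R⦄, r ≤ s → C(X s, X r)}
  {τ : ∀ ⦃r s : Set.Ici R⦄, r ≤ s → C(Y s, Y r)} {P : ℕ → Prop}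
  {g : ∀ q, P q → ∀ r : Set.Ici R, C(X (addIdx r q), Y r)} (hg : IsShiftedMap ρ τ g)
include hg

theorem homologyMap_eq {q q' : ℕ} (hq : P q) (hq' : P q')
    (x : invLim (fun r => Homology G k (X r)) fun _ _ h => homologyMap G k (ρ h))
    (r : Set.Ici R) :
    homologyMap G k (g q hq r) (x.1 (addIdx r q)) =
      homologyMap G k (g q' hq' r) (x.1 (addIdx r q')) := by
  wlog h : q ≤ q' generalizing q q'
  · exact (this hq' hq (le_of_not_ge h)).symm
  rw [← hg.comp_bond_add hq hq' h r, ← homologyMap_homologyMap]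
  exact congrArg _ (x.2 (addIdx r q) (addIdx r q') (Nat.add_le_add_left h r.1)).symm

theorem existsUnique_homology (hP : ∃ q, P q) :
    ∃! f : invLim (fun r => Homology G k (X r)) (fun _ _ h => homologyMap G k (ρ h)) →+
        invLim (fun r => Homology G k (Y r)) fun _ _ h => homologyMap G k (τ h),
      ∀ q (hq : P q) x r, (f x).1 r = homologyMap G k (g q hq r) (x.1 (addIdx r q)) := by
  obtain ⟨q, hq⟩ := hP
  obtain ⟨f, hf, huniq⟩ := existsUnique_hom_invLim (f := fun _ _ h => homologyMap G k (τ h))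
    (L := invLim (fun r => Homology G k (X r)) fun _ _ h => homologyMap G k (ρ h))
    (fun r => (homologyMap G k (g q hq r)).comp (invLimProj (addIdx r q))) fun r s h x => by
      refine (homologyMap_square G k (hg.comp_bond hq h) _).trans ?_
      exact congrArg _ (x.2 (addIdx r q) (addIdx s q) (Nat.add_le_add_right h q))
  exact ⟨f, fun q' hq' x r => (hf x r).trans (hg.homologyMap_eq G k hq hq' x r),
    fun f' hf' => huniq f' (hf' q hq)⟩

theorem of_cohomologyMap_eq {q q' : ℕ} (hq : P q) (hq' : P q') (r : Set.Ici R)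
    (x : Cohomology G k (Y r)) :
    AddCommGroup.DirectLimit.of (fun r => Cohomology G k (X r))
        (fun _ _ h => cohomologyMap G k (ρ h)) (addIdx r q) (cohomologyMap G k (g q hq r) x) =
      AddCommGroup.DirectLimit.of (fun r => Cohomology G k (X r))
        (fun _ _ h => cohomologyMap G k (ρ h)) (addIdx r q')
        (cohomologyMap G k (g q' hq' r) x) := by
  wlog h : q ≤ q' generalizing q q'
  · exact (this hq' hq (le_of_not_ge h)).symm
  have hle : addIdx r q ≤ addIdx r q' := Nat.add_le_add_left h r.1
  rw [← hg.comp_bond_add hq hq' h r, ← cohomologyMap_cohomologyMap]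
  exact (AddCommGroup.DirectLimit.of_f hle _).symm

theorem existsUnique_cohomology (hP : ∃ q, P q) :
    ∃! f : AddCommGroup.DirectLimit (fun r => Cohomology G k (Y r))
          (fun _ _ h => cohomologyMap G k (τ h)) →+
        AddCommGroup.DirectLimit (fun r => Cohomology G k (X r))
          fun _ _ h => cohomologyMap G k (ρ h),
      ∀ q (hq : P q) r x, f (AddCommGroup.DirectLimit.of (fun r => Cohomology G k (Y r))
          (fun _ _ h => cohomologyMap G k (τ h)) r x) =
        AddCommGroup.DirectLimit.of (fun r => Cohomology G k (X r))
          (fun _ _ h => cohomologyMap G k (ρ h)) (addIdx r q)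
          (cohomologyMap G k (g q hq r) x) := by
  obtain ⟨q, hq⟩ := hP
  obtain ⟨f, hf, huniq⟩ := existsUnique_hom_directLimit
    (f := fun _ _ h => cohomologyMap G k (τ h))
    (fun r => (AddCommGroup.DirectLimit.of (fun r => Cohomology G k (X r))
      (fun _ _ h => cohomologyMap G k (ρ h)) (addIdx r q)).comp (cohomologyMap G k (g q hq r)))
    fun r s h x => by
      have hle : addIdx r q ≤ addIdx s q := Nat.add_le_add_right h q
      rw [AddMonoidHom.comp_apply, AddMonoidHom.comp_apply]
      refine (congrArg _ (cohomologyMap_square G k (hg.comp_bond hq h) _)).trans ?_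
      exact AddCommGroup.DirectLimit.of_f hle _
  exact ⟨f, fun q' hq' r x => (hf r x).trans (hg.of_cohomologyMap_eq G k hq hq' r x),
    fun f' hf' => huniq f' (hf' q hq)⟩

end IsShiftedMap

end ShiftedMaps

variable {G k} {A : Type} {D : ℕ} {S : Set (Config A D)} {R : ℕ} {a : Config A D}

theorem existsUnique_isHomologySignature :
    ∃! f : DefectHomology S R a G k →+ ShiftHomology S R G k, IsHomologySignature f := by
  refine existsUnique_hom_invLim
    (f := fun (r s : Set.Ici R) (h : r ≤ s) => homologyMap G k (zeta S h))
    (L := DefectHomology S R a G k) (fun r => (homologyMap G k (sec S a r)).comp (invLimProj r))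
    fun r s h x => ?_
  refine (homologyMap_homologyMap G k _ _ _).trans ?_
  rw [zeta_comp_sec, ← homologyMap_homologyMap]
  exact congrArg _ (x.2 r s h)

theorem existsUnique_isCohomologySignature :
    ∃! f : ShiftCohomology S R G k →+ DefectCohomology S R a G k, IsCohomologySignature f := by
  refine existsUnique_hom_directLimit
    (fun r : Set.Ici R => (DefectCohomology.of S R a G k r).comp (cohomologyMap G k (sec S a r)))
    fun r s h x => ?_
  rw [AddMonoidHom.comp_apply, AddMonoidHom.comp_apply, cohomologyMap_cohomologyMap,
    zeta_comp_sec, ← cohomologyMap_cohomologyMap]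
  exact AddCommGroup.DirectLimit.of_f _ _

variable [TopologicalSpace A] {Φ : Config A D → Config A D}

section Existence

variable (hΦ : IsCellularAutomaton Φ) (hS : Set.MapsTo Φ S S)

theorem isShiftedMap_defectIncl : IsShiftedMap (fun (_ _ : Set.Ici R) h => unflawedIncl S a h)
    (fun (_ _ : Set.Ici R) h => unflawedIncl S (Φ a) h)
    fun _ hq r => defectIncl hΦ hS hq a r where
  comp_bond hq _ _ h := unflawedIncl_comp_defectIncl hΦ hS hq a h
  comp_bond_add hq hq' h r := defectIncl_comp_unflawedIncl_add hΦ hS hq hq' h a r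

theorem isShiftedMap_wangMap : IsShiftedMap (fun (_ _ : Set.Ici R) h => zeta S h)
    (fun (_ _ : Set.Ici R) h => zeta S h) fun _ hq r => wangMap hΦ hS hq r where
  comp_bond hq _ _ h := zeta_comp_wangMap hΦ hS hq h
  comp_bond_add hq hq' h r := wangMap_comp_zeta_add hΦ hS hq hq' h r

variable (hΦr : ∃ q, HasRadius Φ q)
include hΦr

theorem existsUnique_isHomologyInclusion :
    ∃! f : DefectHomology S R a G k →+ DefectHomology S R (Φ a) G k,
      IsHomologyInclusion hΦ hS f :=
  (isShiftedMap_defectIncl hΦ hS).existsUnique_homology G k hΦr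

theorem existsUnique_isHomologyCAMap :
    ∃! f : ShiftHomology S R G k →+ ShiftHomology S R G k, IsHomologyCAMap hΦ hS f :=
  (isShiftedMap_wangMap hΦ hS).existsUnique_homology G k hΦr

theorem existsUnique_isCohomologyInclusion :
    ∃! f : DefectCohomology S R (Φ a) G k →+ DefectCohomology S R a G k,
      IsCohomologyInclusion hΦ hS f :=
  (isShiftedMap_defectIncl hΦ hS).existsUnique_cohomology G k hΦr

theorem existsUnique_isCohomologyCAMap :
    ∃! f : ShiftCohomology S R G k →+ ShiftCohomology S R G k, IsCohomologyCAMap hΦ hS f :=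
  (isShiftedMap_wangMap hΦ hS).existsUnique_cohomology G k hΦr

end Existence

section Squares

variable {hΦ : IsCellularAutomaton Φ} {hS : Set.MapsTo Φ S S}

theorem homology_square (hΦr : ∃ q, HasRadius Φ q)
    {Ha : DefectHomology S R a G k →+ ShiftHomology S R G k}
    {Hb : DefectHomology S R (Φ a) G k →+ ShiftHomology S R G k}
    {Hι : DefectHomology S R a G k →+ DefectHomology S R (Φ a) G k}
    {HΦ : ShiftHomology S R G k →+ ShiftHomology S R G k}
    (ha : IsHomologySignature Ha) (hb : IsHomologySignature Hb)
    (hι : IsHomologyInclusion hΦ hS Hι) (hc : IsHomologyCAMap hΦ hS HΦ) :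
    Hb.comp Hι = HΦ.comp Ha := by
  obtain ⟨q, hq⟩ := hΦr
  refine AddMonoidHom.ext fun x => Subtype.ext (funext fun r => ?_)
  rw [AddMonoidHom.comp_apply, AddMonoidHom.comp_apply, hb, hι q hq, hc q hq, ha]
  exact homologyMap_square G k (sec_comp_defectIncl hΦ hS hq a r) _

theorem cohomology_square (hΦr : ∃ q, HasRadius Φ q)
    {Ha : ShiftCohomology S R G k →+ DefectCohomology S R a G k}
    {Hb : ShiftCohomology S R G k →+ DefectCohomology S R (Φ a) G k}
    {Hι : DefectCohomology S R (Φ a) G k →+ DefectCohomology S R a G k}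
    {HΦ : ShiftCohomology S R G k →+ ShiftCohomology S R G k}
    (ha : IsCohomologySignature Ha) (hb : IsCohomologySignature Hb)
    (hι : IsCohomologyInclusion hΦ hS Hι) (hc : IsCohomologyCAMap hΦ hS HΦ) :
    Hι.comp Hb = Ha.comp HΦ := by
  obtain ⟨q, hq⟩ := hΦr
  refine AddCommGroup.DirectLimit.hom_ext _ fun r => AddMonoidHom.ext fun x => ?_
  refine (congrArg Hι (hb r x)).trans (Eq.trans ?_ (congrArg Ha (hc q hq r x)).symm)
  refine (hι q hq r _).trans (Eq.trans ?_ (ha (addIdx r q) _).symm)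
  exact congrArg _ (cohomologyMap_square G k (sec_comp_defectIncl hΦ hS hq a r) _)

end Squares

end Homology

end DefectSignature

end

open DefectSignature in
theorem theorem3p3_general {A : Type} [TopologicalSpace A] [DiscreteTopology A] {D : ℕ}
    (S : Set (Config A D)) (hS : ShiftInvariant S) (R : ℕ) (a : Config A D) (k : ℕ) :
    (∀ (G : Type*) [AddCommGroup G],
      (∃! f : DefectHomology S R a G k →+ ShiftHomology S R G k, IsHomologySignature f) ∧
      (∃! f : ShiftCohomology S R G k →+ DefectCohomology S R a G k, IsCohomologySignature f)) ∧
    (∀ [NeZero k], BasepointFree S R k → ∀ (ω : ℝ≥0 → Fin D → ℝ) (hω : IsBaseRay S a ω) (c : S),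
      ∃! f : DefectHomotopy S R a k hω.continuous →* ShiftHomotopy S R k c,
        IsHomotopySignature c f) ∧
    (∀ (Φ : Config A D → Config A D) (hΦ : IsCellularAutomaton Φ) (hΦS : Set.MapsTo Φ S S),
      (∃ q, HasRadius Φ q) →
      (∀ (G : Type*) [AddCommGroup G],
        (∃! f : DefectHomology S R a G k →+ DefectHomology S R (Φ a) G k,
          IsHomologyInclusion hΦ hΦS f) ∧
        (∃! f : ShiftHomology S R G k →+ ShiftHomology S R G k, IsHomologyCAMap hΦ hΦS f) ∧
        (∀ (Ha : DefectHomology S R a G k →+ ShiftHomology S R G k)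
            (Hb : DefectHomology S R (Φ a) G k →+ ShiftHomology S R G k)
            (Hι : DefectHomology S R a G k →+ DefectHomology S R (Φ a) G k)
            (HΦ : ShiftHomology S R G k →+ ShiftHomology S R G k),
          IsHomologySignature Ha → IsHomologySignature Hb → IsHomologyInclusion hΦ hΦS Hι →
          IsHomologyCAMap hΦ hΦS HΦ → Hb.comp Hι = HΦ.comp Ha) ∧
        (∃! f : DefectCohomology S R (Φ a) G k →+ DefectCohomology S R a G k,
          IsCohomologyInclusion hΦ hΦS f) ∧
        (∃! f : ShiftCohomology S R G k →+ ShiftCohomology S R G k,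
          IsCohomologyCAMap hΦ hΦS f) ∧
        (∀ (Ha : ShiftCohomology S R G k →+ DefectCohomology S R a G k)
            (Hb : ShiftCohomology S R G k →+ DefectCohomology S R (Φ a) G k)
            (Hι : DefectCohomology S R (Φ a) G k →+ DefectCohomology S R a G k)
            (HΦ : ShiftCohomology S R G k →+ ShiftCohomology S R G k),
          IsCohomologySignature Ha → IsCohomologySignature Hb → IsCohomologyInclusion hΦ hΦS Hι →
          IsCohomologyCAMap hΦ hΦS HΦ → Hι.comp Hb = Ha.comp HΦ)) ∧
      (∀ [NeZero k], BasepointFree S R k → ∀ (ω : ℝ≥0 → Fin D → ℝ) (hω : IsBaseRay S a ω),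
        IsBaseRay S (Φ a) ω ∧
        (∃! f : DefectHomotopy S R a k hω.continuous →* DefectHomotopy S R (Φ a) k hω.continuous,
          IsHomotopyInclusion hΦ hΦS f) ∧
        ∀ c c' : S,
          (∃! f : ShiftHomotopy S R k c →* ShiftHomotopy S R k c',
            IsHomotopyCAMap hΦ hΦS c c' f) ∧
          (∀ (πa : DefectHomotopy S R a k hω.continuous →* ShiftHomotopy S R k c)
              (πb : DefectHomotopy S R (Φ a) k hω.continuous →* ShiftHomotopy S R k c')
              (πι : DefectHomotopy S R a k hω.continuous →*
                DefectHomotopy S R (Φ a) k hω.continuous)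
              (πΦ : ShiftHomotopy S R k c →* ShiftHomotopy S R k c'),
            IsHomotopySignature c πa → IsHomotopySignature c' πb →
            IsHomotopyInclusion hΦ hΦS πι → IsHomotopyCAMap hΦ hΦS c c' πΦ →
              πb.comp πι = πΦ.comp πa))) := by
  refine ⟨fun G _ => ⟨existsUnique_isHomologySignature, existsUnique_isCohomologySignature⟩,
    fun hB ω hω c => ?_, fun Φ hΦ hΦS hΦr => ⟨fun G _ => ?_, fun hB ω hω => ?_⟩⟩
  · have := hB.pathConnectedSpace hS c
    exact existsUnique_isHomotopySignature (hB.towerActsTrivially hS c) hω c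
  · exact ⟨existsUnique_isHomologyInclusion hΦ hΦS hΦr, existsUnique_isHomologyCAMap hΦ hΦS hΦr,
      fun _ _ _ _ => homology_square hΦr, existsUnique_isCohomologyInclusion hΦ hΦS hΦr,
      existsUnique_isCohomologyCAMap hΦ hΦS hΦr, fun _ _ _ _ => cohomology_square hΦr⟩
  · obtain ⟨q, hq⟩ := hΦr
    refine ⟨hω.image hΦ hΦS hq, existsUnique_isHomotopyInclusion hΦ hΦS ⟨q, hq⟩ hω,
      fun c c' => ?_⟩
    have := hB.pathConnectedSpace hS c
    have hT := hB.towerActsTrivially hS c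
    exact ⟨existsUnique_isHomotopyCAMap hΦ hΦS hT ⟨q, hq⟩ c c', fun _ _ _ _ =>
      homotopy_square hT ⟨q, hq⟩ hω⟩

theorem theorem3p3 {A : Type} [Finite A] [TopologicalSpace A] [DiscreteTopology A] {D : ℕ}
    (S : Set (DefectSignature.Config A D)) (R : ℕ) (hS : DefectSignature.IsSFT S R)
    (a : DefectSignature.Config A D) (k : ℕ) :
    -- (a): the homology and cohomology signatures
    (∀ (G : Type*) [AddCommGroup G],
      (∃! f : DefectSignature.DefectHomology S R a G k →+ DefectSignature.ShiftHomology S R G k,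
        DefectSignature.IsHomologySignature f) ∧
      (∃! f : DefectSignature.ShiftCohomology S R G k →+
          DefectSignature.DefectCohomology S R a G k,
        DefectSignature.IsCohomologySignature f)) ∧
    -- (b): the homotopy signature
    (∀ [NeZero k], DefectSignature.BasepointFree S R k →
      ∀ (ω : NNReal → Fin D → ℝ) (hω : DefectSignature.IsBaseRay S a ω) (c : S),
        ∃! f : DefectSignature.DefectHomotopy S R a k hω.continuous →*
            DefectSignature.ShiftHomotopy S R k c,
          DefectSignature.IsHomotopySignature c f) ∧
    -- (c): the commuting squares for a cellular automaton
    (∀ (Φ : DefectSignature.Config A D → DefectSignature.Config A D)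
      (hΦ : DefectSignature.IsCellularAutomaton Φ) (hΦS : Set.MapsTo Φ S S),
      -- homology and cohomology
      (∀ (G : Type*) [AddCommGroup G],
        (∃! f : DefectSignature.DefectHomology S R a G k →+
            DefectSignature.DefectHomology S R (Φ a) G k,
          DefectSignature.IsHomologyInclusion hΦ hΦS f) ∧
        (∃! f : DefectSignature.ShiftHomology S R G k →+ DefectSignature.ShiftHomology S R G k,
          DefectSignature.IsHomologyCAMap hΦ hΦS f) ∧
        (∀ (Ha : DefectSignature.DefectHomology S R a G k →+
              DefectSignature.ShiftHomology S R G k)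
            (Hb : DefectSignature.DefectHomology S R (Φ a) G k →+
              DefectSignature.ShiftHomology S R G k)
            (Hι : DefectSignature.DefectHomology S R a G k →+
              DefectSignature.DefectHomology S R (Φ a) G k)
            (HΦ : DefectSignature.ShiftHomology S R G k →+
              DefectSignature.ShiftHomology S R G k),
          DefectSignature.IsHomologySignature Ha → DefectSignature.IsHomologySignature Hb →
          DefectSignature.IsHomologyInclusion hΦ hΦS Hι →
          DefectSignature.IsHomologyCAMap hΦ hΦS HΦ →
            Hb.comp Hι = HΦ.comp Ha) ∧
        (∃! f : DefectSignature.DefectCohomology S R (Φ a) G k →+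
            DefectSignature.DefectCohomology S R a G k,
          DefectSignature.IsCohomologyInclusion hΦ hΦS f) ∧
        (∃! f : DefectSignature.ShiftCohomology S R G k →+
            DefectSignature.ShiftCohomology S R G k,
          DefectSignature.IsCohomologyCAMap hΦ hΦS f) ∧
        (∀ (Ha : DefectSignature.ShiftCohomology S R G k →+
              DefectSignature.DefectCohomology S R a G k)
            (Hb : DefectSignature.ShiftCohomology S R G k →+
              DefectSignature.DefectCohomology S R (Φ a) G k)
            (Hι : DefectSignature.DefectCohomology S R (Φ a) G k →+
              DefectSignature.DefectCohomology S R a G k)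
            (HΦ : DefectSignature.ShiftCohomology S R G k →+
              DefectSignature.ShiftCohomology S R G k),
          DefectSignature.IsCohomologySignature Ha → DefectSignature.IsCohomologySignature Hb →
          DefectSignature.IsCohomologyInclusion hΦ hΦS Hι →
          DefectSignature.IsCohomologyCAMap hΦ hΦS HΦ →
            Hι.comp Hb = Ha.comp HΦ)) ∧
      -- homotopy
      (∀ [NeZero k], DefectSignature.BasepointFree S R k →
        ∀ (ω : NNReal → Fin D → ℝ) (hω : DefectSignature.IsBaseRay S a ω),
          DefectSignature.IsBaseRay S (Φ a) ω ∧
          (∃! f : DefectSignature.DefectHomotopy S R a k hω.continuous →*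
              DefectSignature.DefectHomotopy S R (Φ a) k hω.continuous,
            DefectSignature.IsHomotopyInclusion hΦ hΦS f) ∧
          ∀ c c' : S,
            (∃! f : DefectSignature.ShiftHomotopy S R k c →* DefectSignature.ShiftHomotopy S R k c',
              DefectSignature.IsHomotopyCAMap hΦ hΦS c c' f) ∧
            (∀ (πa : DefectSignature.DefectHomotopy S R a k hω.continuous →*
                  DefectSignature.ShiftHomotopy S R k c)
                (πb : DefectSignature.DefectHomotopy S R (Φ a) k hω.continuous →*
                  DefectSignature.ShiftHomotopy S R k c')
                (πι : DefectSignature.DefectHomotopy S R a k hω.continuous →*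
                  DefectSignature.DefectHomotopy S R (Φ a) k hω.continuous)
                (πΦ : DefectSignature.ShiftHomotopy S R k c →*
                  DefectSignature.ShiftHomotopy S R k c'),
              DefectSignature.IsHomotopySignature c πa →
              DefectSignature.IsHomotopySignature c' πb →
              DefectSignature.IsHomotopyInclusion hΦ hΦS πι →
              DefectSignature.IsHomotopyCAMap hΦ hΦS c c' πΦ →
                πb.comp πι = πΦ.comp πa))) := by
  obtain ⟨ha, hb, hc⟩ := theorem3p3_general S hS.shiftInvariant R a k
  exact ⟨ha, hb, fun Φ hΦ hΦS => hc Φ hΦ hΦS hΦ.exists_hasRadius⟩
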